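/- Let $\mathfrak g$ be a simple finite-dimensional complex Lie algebra, $\mathfrak h$ a Cartan subalgebra, $\Omega\subset\mathfrak h^*$ the roots, $\Omega^+$ a system of positive roots with simple roots $\Pi$. Let $E_\alpha$ ($\alpha\in\Omega$) be root vectors with $(E_\alpha,E_{-\alpha})=1$ for the Killing form. Let $\Gamma\subset\Pi$, let $\mathfrak h^*_\Gamma$ be the span of $\Gamma$, $\Omega_\Gamma=\Omega\cap\mathfrak h^*_\Gamma$, let $\mathfrak g_\Gamma$ be the Levi subalgebra generated by $\mathfrak h$ and $E_{\pm\alpha}$, $\alpha\in\Gamma$, and let $\mathfrak m$ be its complement spanned by the $E_\gamma$, $\gamma\in\Omega\setminus\Omega_\Gamma$. Let $M=G/G_\Gamma$ be the corresponding semisimple orbit. Invariant polyvector fields on $M$ are identified with $\mathfrak g_\Gamma$-invariant elements of $\wedge^\bullet\mathfrak m\cong\wedge^\bullet(\mathfrak g/\mathfrak g_\Gamma)$; accordingly Schouten brackets on $M$ are computed in $\wedge^\bullet\mathfrak g$ and then reduced to $\wedge^\bullet(\mathfrak g/\mathfrak g_\Gamma)$. Here $[\![X_1\wedge X_2,Y_1\wedge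 Y_2]\!]=\sum_{i,j}(-1)^{i+j}[X_i,Y_j]\wedge X_{3-i}\wedge Y_{3-j}$. Let $r=\sum_{\alpha\in\Omega^+}E_\alpha\wedge E_{-\alpha}$, $\varphi=[\![r,r]\!]$, and let $\varphi_M$ be the reduction of $\varphi$. The nonzero images $\bar\alpha$ of roots in $\mathfrak h^*/\mathfrak h^*_\Gamma\cong\mathfrak h^*_{\Pi\setminus\Gamma}$ are called quasiroots, those of positive roots positive quasiroots, and the images $\bar\alpha_1,\dots,\bar\alpha_k$ of the elements of $\Pi\setminus\Gamma$ simple quasiroots ($k=|\Pi\setminus\Gamma|$). Every positive quasiroot is, uniquely up to order, a sum of simple quasiroots with possible repetitions. Let $K\in\mathbb C$. Given $(c_1,\dots,c_k)\in\mathbb C^k$ and a positive quasiroot $\bar\alpha=\bar\alpha_{i_1}+\cdots+\bar\alpha_{i_l}$ put $$c(\bar\alpha)=\frac{e_l+K^2e_{l-2}+K^4e_{l-4}+\cdots}{e_{l-1}+K^2e_{l-3}+K^4e_{l-5}+\cdots},\qquad(*)$$ where $e_j$ is the $j$-th elementary symmetric polynomial in $c_{i_1},\dots,c_{i_l}$.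 Call $(c_1,\dots,c_k)$ admissible for $K$ if all $c_i\ne0$ and none of the denominators in $(*)$ vanishes, for any positive quasiroot $\bar\alpha$. **(a)** For every $K$, the admissible points are the complement in $\mathbb C^k$ of the zero set of a nonzero polynomial. For every admissible $(c_1,\dots,c_k)$, the numbers $(*)$ satisfy $c(\bar\alpha_i)=c_i$, and the bivector $v=\sum_{\alpha\in\Omega^+\setminus\Omega_\Gamma}c(\bar\alpha)\,E_\alpha\wedge E_{-\alpha}$ lies in $\wedge^2\mathfrak m$, is $\mathfrak g_\Gamma$-invariant and satisfies $[\![v,v]\!]=K^2\varphi_M$ on $M$; moreover $(*)$ gives the only system of numbers $c(\bar\alpha)$, indexed by the positive quasiroots, with $c(\bar\alpha_i)=c_i$ for all $i$ for which $[\![v,v]\!]=K^2\varphi_M$. Thus $(c_1,\dots,c_k)\mapsto v$ is a bijection from the set of admissible points onto the set of $\mathfrak g_\Gamma$-invariant bivectors $v=\sum c(\bar\alpha)E_\alpha\wedge E_{-\alpha}$ in $\wedge^2\mathfrak m$ with $[\![v,v]\!]=K^2\varphi_M$ whose coefficients at the simple quasiroots form an admissible point: these brackets form a $k$-parameter family.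 **(b)** Let $K=0$, and let $v=\sum c(\bar\alpha)E_\alpha\wedge E_{-\alpha}$ be any solution of $[\![v,v]\!]=K^2\varphi_M=0$ on $M$ (for instance one of those in (a)). Then $v$ defines a Poisson bracket on $M$: whenever $\mathfrak g$ acts by derivations on a commutative $\mathbb C$-algebra $A$ (such as the functions on the preimage in $G$ of an open subset of $M$, with $\mathfrak g$ acting by left invariant vector fields), $\{a,b\}=\sum c(\bar\alpha)\,(E_\alpha a\,E_{-\alpha}b-E_{-\alpha}a\,E_\alpha b)$ is a Poisson bracket on the algebra of elements of $A$ annihilated by $\mathfrak g_\Gamma$. If moreover $c(\bar\alpha_i)\ne0$ for all simple quasiroots, there is a linear form $\lambda$ on $\mathfrak h^*/\mathfrak h^*_\Gamma\cong\mathfrak h^*_{\Pi\setminus\Gamma}$, nonzero on all quasiroots, such that $c(\bar\alpha)=1/\lambda(\bar\alpha)$ for all positive quasiroots $\bar\alpha$. -/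

import Mathlib

open Module LieAlgebra.IsKilling

universe u w

noncomputable section

namespace SemisimpleOrbit

/-! ### Bivectors and trivectors over a vector space, and the Schouten bracket -/

section Multilinear

variable {V N : Type*} [AddCommGroup V] [Module ℂ V] [AddCommGroup N] [Module ℂ N]

/-- The decomposable bivector `x ∧ y`. -/
def wedge₂ (x y : V) : ⋀[ℂ]^2 V := exteriorPower.ιMulti ℂ 2 ![x, y]

/-- The decomposable trivector `x ∧ y ∧ z`. -/
def wedge₃ (x y z : V) : ⋀[ℂ]^3 V := exteriorPower.ιMulti ℂ 3 ![x, y, z]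

/-- The linear map `⋀² V → N` with `x ∧ y ↦ B x y`, for an alternating bilinear map `B`
(universal property of the second exterior power). -/
def liftBilin (B : V →ₗ[ℂ] V →ₗ[ℂ] N) (hB : ∀ x, B x x = 0) : ⋀[ℂ]^2 V →ₗ[ℂ] N :=
  exteriorPower.alternatingMapLinearEquiv
    { toFun := fun m => B (m 0) (m 1)
      map_update_add' := by
        intro _ m i x y
        fin_cases i <;> simp
      map_update_smul' := by
        intro _ m i c x
        fin_cases i <;> simp
      map_eq_zero_of_eq' := by
        intro m i j h hij
        fin_cases i <;> fin_cases j <;> simp_all }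

theorem liftBilin_wedge₂ (B : V →ₗ[ℂ] V →ₗ[ℂ] N) (hB : ∀ x, B x x = 0) (x y : V) :
    liftBilin B hB (wedge₂ x y) = B x y := by
  simp [liftBilin, wedge₂]

theorem coe_wedge₂ (x y : V) : (wedge₂ x y : ExteriorAlgebra ℂ V) =
    ExteriorAlgebra.ι ℂ x * ExteriorAlgebra.ι ℂ y := by
  simp [wedge₂, ExteriorAlgebra.ιMulti_apply]

theorem coe_wedge₃ (x y z : V) : (wedge₃ x y z : ExteriorAlgebra ℂ V) =
    ExteriorAlgebra.ι ℂ x * (ExteriorAlgebra.ι ℂ y * ExteriorAlgebra.ι ℂ z) := by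
  simp [wedge₃, ExteriorAlgebra.ιMulti_apply]

end Multilinear

section Schouten

variable {g : Type*} [LieRing g] [LieAlgebra ℂ g]

/-- The value of the Schouten bracket on decomposable bivectors,
`⟦x₁ ∧ x₂, y₁ ∧ y₂⟧ = ∑ i j, (-1)^(i+j) [xᵢ, yⱼ] ∧ x_{3-i} ∧ y_{3-j}`. -/
def schoutenDecomp (x₁ x₂ y₁ y₂ : g) : ⋀[ℂ]^3 g :=
  wedge₃ ⁅x₁, y₁⁆ x₂ y₂ - wedge₃ ⁅x₁, y₂⁆ x₂ y₁ - wedge₃ ⁅x₂, y₁⁆ x₁ y₂ + wedge₃ ⁅x₂, y₂⁆ x₁ y₁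

/-- The Schouten bracket of a decomposable bivector with an arbitrary one. -/
def schoutenRight (x₁ x₂ : g) : ⋀[ℂ]^2 g →ₗ[ℂ] ⋀[ℂ]^3 g :=
  liftBilin
    (LinearMap.mk₂ ℂ (schoutenDecomp x₁ x₂)
      (by intros; apply Subtype.ext
          simp [schoutenDecomp, coe_wedge₃, mul_add, add_mul]; abel)
      (by intros; apply Subtype.ext
          simp [schoutenDecomp, coe_wedge₃, smul_sub, smul_add])
      (by intros; apply Subtype.ext
          simp [schoutenDecomp, coe_wedge₃, mul_add, add_mul]; abel)
      (by intros; apply Subtype.ext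
          simp [schoutenDecomp, coe_wedge₃, smul_sub, smul_add]))
    (by intro y; simp [schoutenDecomp])

theorem schoutenRight_wedge₂ (x₁ x₂ y₁ y₂ : g) :
    schoutenRight x₁ x₂ (wedge₂ y₁ y₂) = schoutenDecomp x₁ x₂ y₁ y₂ := by
  simp [schoutenRight, liftBilin_wedge₂]

theorem bivector_hom_ext {N : Type*} [AddCommGroup N] [Module ℂ N]
    {f h : ⋀[ℂ]^2 g →ₗ[ℂ] N} (H : ∀ x y, f (wedge₂ x y) = h (wedge₂ x y)) : f = h := by
  apply exteriorPower.linearMap_ext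
  ext m
  have : m = ![m 0, m 1] := by ext i; fin_cases i <;> rfl
  rw [this]
  exact H _ _

/-- The Schouten bracket `⟦·,·⟧ : ⋀² g × ⋀² g → ⋀³ g`. -/
def schouten : ⋀[ℂ]^2 g →ₗ[ℂ] ⋀[ℂ]^2 g →ₗ[ℂ] ⋀[ℂ]^3 g :=
  liftBilin
    (LinearMap.mk₂ ℂ schoutenRight
      (by intros; apply bivector_hom_ext; intros; apply Subtype.ext
          simp [schoutenRight_wedge₂, schoutenDecomp, coe_wedge₃, mul_add, add_mul]; abel)
      (by intros; apply bivector_hom_ext; intros; apply Subtype.ext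
          simp [schoutenRight_wedge₂, schoutenDecomp, coe_wedge₃, smul_sub, smul_add])
      (by intros; apply bivector_hom_ext; intros; apply Subtype.ext
          simp [schoutenRight_wedge₂, schoutenDecomp, coe_wedge₃, mul_add, add_mul]; abel)
      (by intros; apply bivector_hom_ext; intros; apply Subtype.ext
          simp [schoutenRight_wedge₂, schoutenDecomp, coe_wedge₃, smul_sub, smul_add]))
    (by intro x; apply bivector_hom_ext; intros
        simp [schoutenRight_wedge₂, schoutenDecomp])

theorem schouten_wedge₂ (x₁ x₂ y₁ y₂ : g) :
    schouten (wedge₂ x₁ x₂) (wedge₂ y₁ y₂) = schoutenDecomp x₁ x₂ y₁ y₂ := by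
  simp [schouten, liftBilin_wedge₂, schoutenRight_wedge₂]

/-- The adjoint action of `x` on bivectors, `y ∧ z ↦ [x, y] ∧ z + y ∧ [x, z]`. -/
def adBivector (x : g) : ⋀[ℂ]^2 g →ₗ[ℂ] ⋀[ℂ]^2 g :=
  liftBilin
    (LinearMap.mk₂ ℂ (fun y z => wedge₂ ⁅x, y⁆ z + wedge₂ y ⁅x, z⁆)
      (by intros; apply Subtype.ext; simp [coe_wedge₂, add_mul]; abel)
      (by intros; apply Subtype.ext; simp [coe_wedge₂, smul_add])
      (by intros; apply Subtype.ext; simp [coe_wedge₂, mul_add]; abel)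
      (by intros; apply Subtype.ext; simp [coe_wedge₂, smul_add]))
    (by
      intro y
      apply Subtype.ext
      simp only [LinearMap.mk₂_apply, Submodule.coe_add, coe_wedge₂, Submodule.coe_zero]
      exact ExteriorAlgebra.ι_add_mul_swap _ _)

/-- The biderivation `{a, b} = v(da, db)` which a bivector `v` over `g` defines on a commutative
algebra `A` on which `g` acts by derivations: for `v = x ∧ y` it is
`{a, b} = x(a) y(b) - y(a) x(b)`. -/
def bivectorBracket {A : Type*} [CommRing A] [Algebra ℂ A]
    (ρ : g →ₗ⁅ℂ⁆ Derivation ℂ A A) (v : ⋀[ℂ]^2 g) (a b : A) : A :=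
  liftBilin
    (LinearMap.mk₂ ℂ (fun x y => ρ x a * ρ y b - ρ y a * ρ x b)
      (by intros; simp; ring)
      (by intros; simp [smul_sub])
      (by intros; simp; ring)
      (by intros; simp [smul_sub]))
    (by intro x; simp) v

/-- `br` is a Poisson bracket on the commutative algebra formed by the elements of `S ⊆ A`. -/
structure IsPoissonBracketOn {A : Type*} [CommRing A] [Algebra ℂ A] (S : Set A)
    (br : A → A → A) : Prop where
  mem : ∀ a ∈ S, ∀ b ∈ S, br a b ∈ S
  add : ∀ a ∈ S, ∀ b ∈ S, ∀ c ∈ S, br a (b + c) = br a b + br a c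
  smul : ∀ (t : ℂ), ∀ a ∈ S, ∀ b ∈ S, br a (t • b) = t • br a b
  skew : ∀ a ∈ S, ∀ b ∈ S, br a b = -br b a
  leibniz : ∀ a ∈ S, ∀ b ∈ S, ∀ c ∈ S, br a (b * c) = br a b * c + b * br a c
  jacobi : ∀ a ∈ S, ∀ b ∈ S, ∀ c ∈ S, br a (br b c) + br b (br c a) + br c (br a b) = 0

end Schouten

/-! ### Formula for the coefficients -/

/-- The numerator `e_l + K² e_{l-2} + K⁴ e_{l-4} + ⋯` in the numbers `c₁, …, c_l`, where `e_j` is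
the `j`-th elementary symmetric polynomial. -/
def numer (K : ℂ) (s : Multiset ℂ) : ℂ :=
  ∑ j ∈ Finset.range (s.card / 2 + 1), K ^ (2 * j) * s.esymm (s.card - 2 * j)

/-- The denominator `e_{l-1} + K² e_{l-3} + K⁴ e_{l-5} + ⋯` in the numbers `c₁, …, c_l`. -/
def denom (K : ℂ) (s : Multiset ℂ) : ℂ :=
  ∑ j ∈ Finset.range ((s.card + 1) / 2), K ^ (2 * j) * s.esymm (s.card - (2 * j + 1))

/-! ### Levi subalgebras, quasiroots, and invariant brackets -/

section Lie

variable {g : Type*} [LieRing g] [LieAlgebra ℂ g] [FiniteDimensional ℂ g]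
  [LieAlgebra.IsKilling ℂ g]
  {H : LieSubalgebra ℂ g} [H.IsCartanSubalgebra]

/-- A choice of root vectors `E_α` with `(E_α, E_{-α}) = 1` for the Killing form. (Only the values
of `E` at the nonzero weights, i.e. at the roots, matter.) -/
structure IsRootVectors (E : LieModule.Weight ℂ H g → g) : Prop where
  mem : ∀ α : LieModule.Weight ℂ H g, α.IsNonZero → E α ∈ LieAlgebra.rootSpace H α
  killing : ∀ α : LieModule.Weight ℂ H g, α.IsNonZero → killingForm ℂ g (E α) (E (-α)) = 1

/-- `h*_Γ`, the subspace of `h*` spanned by `Γ`. -/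
def hGamma (Γ : Set H.root) : Submodule ℂ (Dual ℂ H) :=
  Submodule.span ℂ ((rootSystem H).root '' Γ)

/-- The image of the root `α` in `h*/h*_Γ`. -/
def bar (Γ : Set H.root) (α : H.root) : Dual ℂ H ⧸ hGamma Γ :=
  (hGamma Γ).mkQ ((rootSystem H).root α)

/-- `α` does not lie in the subsystem `Ω_Γ = Ω ∩ h*_Γ`. -/
def IsOutside (Γ : Set H.root) (α : H.root) : Prop := (rootSystem H).root α ∉ hGamma Γ

/-- Quasiroots: the nonzero images of the roots in `h*/h*_Γ`. -/
def quasiroots (Γ : Set H.root) : Set (Dual ℂ H ⧸ hGamma Γ) :=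
  {q | q ≠ 0 ∧ ∃ α : H.root, bar Γ α = q}

/-- Positive quasiroots: the nonzero images of the positive roots. -/
abbrev PosQuasiroot (b : (rootSystem H).Base) (Γ : Set H.root) : Type _ :=
  {q : Dual ℂ H ⧸ hGamma Γ // q ≠ 0 ∧ ∃ α : H.root, b.IsPos α ∧ bar Γ α = q}

/-- `Ω⁺ ∖ Ω_Γ`. -/
abbrev PosOutside (b : (rootSystem H).Base) (Γ : Set H.root) : Type _ :=
  {α : H.root // b.IsPos α ∧ IsOutside Γ α}

/-- `Π ∖ Γ`, which indexes the simple quasiroots. -/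
abbrev SimpleOutside (b : (rootSystem H).Base) (Γ : Set H.root) : Type _ :=
  {α : H.root // α ∈ b.support ∧ α ∉ Γ}

variable {b : (rootSystem H).Base} {Γ : Set H.root}

/-- The positive quasiroot `ᾱ` of a root `α ∈ Ω⁺ ∖ Ω_Γ`. -/
def PosOutside.bar (α : PosOutside b Γ) : PosQuasiroot b Γ :=
  ⟨SemisimpleOrbit.bar Γ α.1,
    fun h => α.2.2 (by simpa [SemisimpleOrbit.bar] using h), α.1, α.2.1, rfl⟩

theorem coord_eq_zero (hΓ : Γ ⊆ b.support) (i : b.support) (hi : i.1 ∉ Γ) :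
    hGamma Γ ≤ LinearMap.ker (b.toWeightBasis.coord i) := by
  classical
  rw [hGamma, Submodule.span_le]
  rintro _ ⟨j, hj, rfl⟩
  have := b.toWeightBasis_repr_root ⟨j, hΓ hj⟩
  simp only [SetLike.mem_coe, LinearMap.mem_ker, Basis.coord_apply]
  rw [this, Finsupp.single_apply, if_neg]
  rintro rfl
  exact hi hj

theorem simple_isOutside (hΓ : Γ ⊆ b.support) (i : SimpleOutside b Γ) : IsOutside Γ i.1 := by
  intro h
  have h1 := coord_eq_zero hΓ ⟨i.1, i.2.1⟩ i.2.2 h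
  have h2 := b.toWeightBasis_repr_root ⟨i.1, i.2.1⟩
  simp only [LinearMap.mem_ker, Basis.coord_apply] at h1
  rw [h2] at h1
  simp at h1

/-- A simple root outside `Γ`, as an element of `Ω⁺ ∖ Ω_Γ`. -/
def SimpleOutside.toPosOutside (hΓ : Γ ⊆ b.support) (i : SimpleOutside b Γ) : PosOutside b Γ :=
  ⟨i.1, b.isPos_of_mem_support i.2.1, simple_isOutside hΓ i⟩

/-- The simple quasiroot `ᾱᵢ`. -/
def simpleQuasiroot (hΓ : Γ ⊆ b.support) (i : SimpleOutside b Γ) : PosQuasiroot b Γ :=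
  (i.toPosOutside hΓ).bar

/-- Every positive quasiroot is, in exactly one way, a sum `ᾱ₁ + ⋯ + ᾱ_l` of simple quasiroots
with possible repetitions. -/
theorem existsUnique_decomposition (hΓ : Γ ⊆ b.support) (q : PosQuasiroot b Γ) :
    ∃! s : Multiset (SimpleOutside b Γ),
      (s.map fun i => (simpleQuasiroot hΓ i).1).sum = q.1 := by
  classical
  have huniq : ∀ (i : SimpleOutside b Γ) (s : Multiset (SimpleOutside b Γ)),
      (hGamma Γ).liftQ _ (coord_eq_zero hΓ ⟨i.1, i.2.1⟩ i.2.2)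
        (s.map fun i => (simpleQuasiroot hΓ i).1).sum = (s.count i : ℂ) := by
    intro i s
    induction s using Multiset.induction_on with
    | empty => simp
    | cons j s ih =>
      rw [Multiset.map_cons, Multiset.sum_cons, map_add, ih, Multiset.count_cons]
      have h2 := b.toWeightBasis_repr_root ⟨j.1, j.2.1⟩
      have h3 : (hGamma Γ).liftQ _ (coord_eq_zero hΓ ⟨i.1, i.2.1⟩ i.2.2)
          (simpleQuasiroot hΓ j).1 = if i = j then 1 else 0 := by
        change b.toWeightBasis.repr ((rootSystem H).root j.1) ⟨i.1, i.2.1⟩ = _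
        rw [h2, Finsupp.single_apply]
        by_cases hij : i = j
        · subst hij; simp
        · have : ¬ j.1 = i.1 := fun h => hij (Subtype.ext h.symm)
          simp [hij, this]
      rw [h3]
      push_cast
      ring
  obtain ⟨q, hq, α, hα, rfl⟩ := q
  have hex : ∃ s : Multiset (SimpleOutside b Γ),
      (s.map fun i => (simpleQuasiroot hΓ i).1).sum = bar Γ α := by
    clear hq
    refine RootPairing.Base.IsPos.induction_on_add (b := b) hα (p := fun α =>
      ∃ s : Multiset (SimpleOutside b Γ),
        (s.map fun i => (simpleQuasiroot hΓ i).1).sum = bar Γ α) ?_ ?_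
    · intro i hi
      by_cases hiΓ : i ∈ Γ
      · refine ⟨0, ?_⟩
        have : (rootSystem H).root i ∈ hGamma Γ := Submodule.subset_span ⟨i, hiΓ, rfl⟩
        have h0 : bar Γ i = 0 := by simpa [bar] using this
        simp [h0]
      · exact ⟨{⟨i, hi, hiΓ⟩}, by simp [simpleQuasiroot, PosOutside.bar,
          SimpleOutside.toPosOutside]⟩
    · intro i j k hijk ih hj
      obtain ⟨s, hs⟩ := ih
      have hk : bar Γ k = bar Γ i + bar Γ j := by simp only [bar, hijk, map_add]
      by_cases hjΓ : j ∈ Γ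
      · refine ⟨s, ?_⟩
        have : (rootSystem H).root j ∈ hGamma Γ := Submodule.subset_span ⟨j, hjΓ, rfl⟩
        have h0 : bar Γ j = 0 := by simpa [bar] using this
        rw [hs, hk, h0, add_zero]
      · refine ⟨⟨j, hj, hjΓ⟩ ::ₘ s, ?_⟩
        rw [Multiset.map_cons, Multiset.sum_cons, hs, hk, add_comm]
        rfl
  obtain ⟨s, hs⟩ := hex
  refine ⟨s, hs, fun t ht => ?_⟩
  ext i
  have h1 := huniq i s
  have h2 := huniq i t
  rw [hs] at h1
  rw [ht] at h2
  exact_mod_cast h2.symm.trans h1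

/-- The multiset of simple quasiroots `ᾱ₁, …, ᾱ_l` whose sum is the given positive quasiroot. -/
def decomposition (hΓ : Γ ⊆ b.support) (q : PosQuasiroot b Γ) : Multiset (SimpleOutside b Γ) :=
  (existsUnique_decomposition hΓ q).choose

/-- The values `c₁, …, c_l` (with repetitions) at the simple quasiroots occurring in `q`. -/
def simpleValues (hΓ : Γ ⊆ b.support) (c : SimpleOutside b Γ → ℂ) (q : PosQuasiroot b Γ) :
    Multiset ℂ :=
  (decomposition hΓ q).map c

/-- The number `c(ᾱ)` computed from the values `cᵢ` at the simple quasiroots: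
`c(ᾱ) = (e_l + K² e_{l-2} + ⋯) / (e_{l-1} + K² e_{l-3} + ⋯)` for `ᾱ = ᾱ₁ + ⋯ + ᾱ_l`. -/
def coeffFormula (hΓ : Γ ⊆ b.support) (K : ℂ) (c : SimpleOutside b Γ → ℂ) :
    PosQuasiroot b Γ → ℂ :=
  fun q => numer K (simpleValues hΓ c q) / denom K (simpleValues hΓ c q)

/-- The admissible points `(c₁, …, c_k) ∈ ℂ^k`: all `cᵢ` are nonzero and no denominator
vanishes. -/
def admissible (hΓ : Γ ⊆ b.support) (K : ℂ) : Set (SimpleOutside b Γ → ℂ) :=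
  {c | (∀ i, c i ≠ 0) ∧ ∀ q : PosQuasiroot b Γ, denom K (simpleValues hΓ c q) ≠ 0}

variable (E : LieModule.Weight ℂ H g → g)

/-- The Levi subalgebra `g_Γ`, generated by `h` and `E_α`, `E_{-α}`, `α ∈ Γ`. -/
def levi (Γ : Set H.root) : LieSubalgebra ℂ g :=
  LieSubalgebra.lieSpan ℂ g ((H : Set g) ∪ {x | ∃ α ∈ Γ, x = E α.1 ∨ x = E (-α.1)})

/-- The complement `m` of `g_Γ` in `g`, spanned by the `E_γ` with `γ ∈ Ω ∖ Ω_Γ`. -/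
def mGamma (Γ : Set H.root) : Submodule ℂ g :=
  Submodule.span ℂ {x | ∃ α : H.root, IsOutside Γ α ∧ x = E α.1}

/-- The subspace `⋀² m` of `⋀² g`. -/
def bivectorsInM (Γ : Set H.root) : Submodule ℂ (⋀[ℂ]^2 g) :=
  LinearMap.range (exteriorPower.map 2 (mGamma E Γ).subtype)

/-- Invariance of a bivector under the adjoint action of `g_Γ`. The `g_Γ`-invariant elements of
`⋀² m` are identified with the invariant bivector fields on `M = G/G_Γ`. -/
def IsLeviInvariant (Γ : Set H.root) (v : ⋀[ℂ]^2 g) : Prop :=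
  ∀ x ∈ levi E Γ, adBivector x v = 0

/-- The value at the base point of `M = G/G_Γ` of the trivector field on `M` defined by a trivector
over `g`, i.e. the image in `⋀³ T_oM`, where `T_oM = g/g_Γ ≅ m`. -/
def toM (Γ : Set H.root) : ⋀[ℂ]^3 g →ₗ[ℂ] ⋀[ℂ]^3 (g ⧸ (levi E Γ).toSubmodule) :=
  exteriorPower.map 3 (levi E Γ).toSubmodule.mkQ

/-- The Drinfeld-Jimbo `r`-matrix `r = ∑_{α ∈ Ω⁺} E_α ∧ E_{-α}`. -/
def rMatrix (b : (rootSystem H).Base) : ⋀[ℂ]^2 g :=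
  letI := Fintype.ofFinite {α : H.root // b.IsPos α}
  ∑ α : {α : H.root // b.IsPos α}, wedge₂ (E α.1.1) (E (-α.1.1))

/-- The invariant trivector `φ = ⟦r, r⟧` reduced to `M`. -/
def phiM (b : (rootSystem H).Base) (Γ : Set H.root) : ⋀[ℂ]^3 (g ⧸ (levi E Γ).toSubmodule) :=
  toM E Γ (schouten (rMatrix E b) (rMatrix E b))

/-- The bivector `∑ c(ᾱ) E_α ∧ E_{-α}`, summed over `α ∈ Ω⁺ ∖ Ω_Γ`. -/
def bivector (c : PosQuasiroot b Γ → ℂ) : ⋀[ℂ]^2 g :=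
  letI := Fintype.ofFinite (PosOutside b Γ)
  ∑ α : PosOutside b Γ, c α.bar • wedge₂ (E α.1.1) (E (-α.1.1))

/-- The condition `⟦v, v⟧ = K² φ_M` on `M`. -/
def SatisfiesSchouten (b : (rootSystem H).Base) (Γ : Set H.root) (K : ℂ) (v : ⋀[ℂ]^2 g) : Prop :=
  toM E Γ (schouten v v) = K ^ 2 • phiM E b Γ

/-- The invariant bivector fields `v = ∑ c(ᾱ) E_α ∧ E_{-α}` on `M` with `⟦v, v⟧ = K² φ_M` whose
coefficients at the simple quasiroots form an admissible point. -/
def bracketFamily (hΓ : Γ ⊆ b.support) (K : ℂ) : Set (⋀[ℂ]^2 g) :=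
  {v | v ∈ bivectorsInM E Γ ∧ IsLeviInvariant E Γ v ∧ SatisfiesSchouten E b Γ K v ∧
    ∃ d : PosQuasiroot b Γ → ℂ, v = bivector E d ∧
      (fun i => d (simpleQuasiroot hΓ i)) ∈ admissible hΓ K}

/-- The bivector `v` defines a Poisson bracket on `M = G/G_Γ`.
The functions on an open set `U ⊆ M` are the functions on its preimage in `G` (a commutative
algebra `A` on which `g` acts by left invariant vector fields) which are annihilated by `g_Γ`, and
the bracket of two of them is obtained by applying the left invariant bivector field `v`. The
condition is imposed for every commutative algebra `A` with an action of `g` by derivations. -/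
def DefinesPoissonBracket (Γ : Set H.root) (v : ⋀[ℂ]^2 g) : Prop :=
  ∀ (A : Type w) [CommRing A] [Algebra ℂ A] (ρ : g →ₗ⁅ℂ⁆ Derivation ℂ A A),
    IsPoissonBracketOn {a : A | ∀ x ∈ levi E Γ, ρ x a = 0} (bivectorBracket ρ v)

end Lie

end SemisimpleOrbit

end

open SemisimpleOrbit

noncomputable section

namespace SemisimpleOrbit

/-! ### Recursions for the numerators and denominators -/

/-! The Killing form turns a bivector `v` into an endomorphism `contract v` of `g`. For `v = ∑ c(ᾱ)
E_α ∧ E_{-α}` this endomorphism is scalar on each root space. The scalar is an odd function of the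
quasiroot, equal to `-c(ᾱ)` at a positive `ᾱ` and to `0` on `H` and on the root spaces of `Ω_Γ`
(`contract_bivector`). It depends on the weight only modulo `h*_Γ`, so `contract v` commutes with
`ad g_Γ`; this is the invariance of `v`.

Paired with three eigenvectors of eigenvalues `t₁, t₂, t₃`, the Schouten square of `v` gives `2
(t₁t₂ + t₂t₃ + t₃t₁) ([y₁, y₂], y₃)` (`pair₃_schouten_of_eigen`). For root vectors the last factor
is nonzero exactly when the roots sum to zero. Since `r` has eigenvalues `±1`, the equation `⟦v, v⟧
= K² φ_M` becomes `c(γ̄)(c(ᾱ) + c(β̄)) = c(ᾱ)c(β̄) + K²` for all `γ = α + β` in `Ω⁺ ∖ Ω_Γ`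
(`satisfiesSchouten_iff`), which is the addition law of the hyperbolic cotangent.

If `N` and `D` are the numerator and denominator in `(*)`, then `N + K D = ∏ (cᵢ + K)`, formally in
a square root `K` of `K²`. Multiplicativity of the right side gives the addition formulas
`numer_denom_add`, hence existence. Conversely, positive quasiroots are built by adding simple ones
(`posQuasiroot_induction`), and at each step the nonvanishing denominators make the relation
determine the new coefficient (`eq_coeffFormula`).

For `K = 0` the relation says that `1/c` is additive, so it is linear when the simple coefficients
are nonzero. The Jacobiator of the bracket of `v` is its Schouten square evaluated on three
functions (`jacobiator`). Functions killed by `g_Γ` only see the reduction to `g/g_Γ`, which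
vanishes. -/

theorem esymm_cons_succ (a : ℂ) (s : Multiset ℂ) (n : ℕ) :
    (a ::ₘ s).esymm (n + 1) = s.esymm (n + 1) + a * s.esymm n := by
  simp [Multiset.esymm, Multiset.powersetCard_cons, Multiset.sum_map_mul_left]

theorem esymm_eq_zero_of_card_lt (s : Multiset ℂ) {n : ℕ} (h : s.card < n) : s.esymm n = 0 := by
  simp [Multiset.esymm, Multiset.powersetCard_eq_empty n h]

theorem esymm_zero_right (s : Multiset ℂ) : s.esymm 0 = 1 := by
  simp [Multiset.esymm]

theorem numer_zero (K : ℂ) : numer K 0 = 1 := by simp [numer, esymm_zero_right]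

theorem denom_zero (K : ℂ) : denom K 0 = 0 := by simp [denom]

/-- The Pascal rule for `e_j`, applied term by term. The parity of the cardinality decides whether
the last term is `e_0`, which has no partner in `a * denom K s`. -/
theorem denom_cons (K a : ℂ) (s : Multiset ℂ) :
    denom K (a ::ₘ s) = a * denom K s + numer K s := by
  simp only [denom, numer, Multiset.card_cons]
  rcases Nat.even_or_odd' s.card with ⟨m, hm | hm⟩
  · rw [hm, show (2 * m + 1 + 1) / 2 = m + 1 by omega, show (2 * m + 1) / 2 = m by omega,
      show 2 * m / 2 + 1 = m + 1 by omega, Finset.sum_range_succ,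
      Finset.sum_range_succ _ m, Finset.mul_sum, ← add_assoc, ← Finset.sum_add_distrib]
    congr 1
    · refine Finset.sum_congr rfl fun j hj => ?_
      have := Finset.mem_range.1 hj
      rw [show 2 * m + 1 - (2 * j + 1) = (2 * m - (2 * j + 1)) + 1 by omega, esymm_cons_succ,
        show 2 * m - (2 * j + 1) + 1 = 2 * m - 2 * j by omega]
      ring
    · simp [esymm_zero_right]
  · rw [hm, show (2 * m + 1 + 1 + 1) / 2 = m + 1 by omega,
      show (2 * m + 1 + 1) / 2 = m + 1 by omega,
      show (2 * m + 1) / 2 + 1 = m + 1 by omega, Finset.mul_sum, ← Finset.sum_add_distrib]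
    refine Finset.sum_congr rfl fun j hj => ?_
    have := Finset.mem_range.1 hj
    rw [show 2 * m + 1 + 1 - (2 * j + 1) = (2 * m + 1 - (2 * j + 1)) + 1 by omega,
      esymm_cons_succ, show 2 * m + 1 - (2 * j + 1) + 1 = 2 * m + 1 - 2 * j by omega]
    ring

theorem numer_cons (K a : ℂ) (s : Multiset ℂ) :
    numer K (a ::ₘ s) = a * numer K s + K ^ 2 * denom K s := by
  simp only [denom, numer, Multiset.card_cons]
  have key : ∀ j, 2 * j ≤ s.card → K ^ (2 * j) * (a ::ₘ s).esymm (s.card + 1 - 2 * j) =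
      a * (K ^ (2 * j) * s.esymm (s.card - 2 * j)) +
        K ^ (2 * j) * s.esymm (s.card + 1 - 2 * j) := by
    intro j hj
    rw [show s.card + 1 - 2 * j = (s.card - 2 * j) + 1 by omega, esymm_cons_succ]
    ring
  -- The leading term of this sum is `e_{l+1}` of `l` numbers, which vanishes; dropping it shifts
  -- the index and produces the factor `K ^ 2`.
  have shift : ∀ N, 2 * N ≤ s.card + 1 →
      ∑ j ∈ Finset.range (N + 1), K ^ (2 * j) * s.esymm (s.card + 1 - 2 * j) =
      K ^ 2 * ∑ j ∈ Finset.range N, K ^ (2 * j) * s.esymm (s.card - (2 * j + 1)) := by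
    intro N hN
    rw [Finset.sum_range_succ', esymm_eq_zero_of_card_lt s (by omega), Finset.mul_sum]
    simp only [mul_zero, add_zero]
    refine Finset.sum_congr rfl fun j hj => ?_
    rw [show s.card + 1 - 2 * (j + 1) = s.card - (2 * j + 1) by omega]
    ring
  rcases Nat.even_or_odd' s.card with ⟨m, hm | hm⟩
  · rw [show (s.card + 1) / 2 = m by omega, show s.card / 2 = m by omega, ← shift m (by omega),
      Finset.mul_sum, ← Finset.sum_add_distrib]
    exact Finset.sum_congr rfl fun j hj => key j (by have := Finset.mem_range.1 hj; omega)
  · rw [show (s.card + 1) / 2 = m + 1 by omega, show s.card / 2 = m by omega,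
      ← shift (m + 1) (by omega), Finset.sum_range_succ, Finset.sum_range_succ _ (m + 1),
      Finset.mul_sum, ← add_assoc, ← Finset.sum_add_distrib]
    congr 1
    · exact Finset.sum_congr rfl fun j hj => key j (by have := Finset.mem_range.1 hj; omega)
    · rw [show s.card + 1 - 2 * (m + 1) = 0 by omega]
      simp [esymm_zero_right]

/-- Multiplicativity of `N + K D = ∏ (cᵢ + K)`, separated into its even and odd parts in `K`. -/
theorem numer_denom_add (K : ℂ) (s t : Multiset ℂ) :
    numer K (s + t) = numer K s * numer K t + K ^ 2 * (denom K s * denom K t) ∧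
      denom K (s + t) = denom K s * numer K t + numer K s * denom K t := by
  induction s using Multiset.induction_on with
  | empty => simp [numer_zero, denom_zero]
  | cons a s ih =>
    simp only [Multiset.cons_add, numer_cons, denom_cons, ih.1, ih.2]
    constructor <;> ring

theorem numer_singleton (K a : ℂ) : numer K {a} = a := by
  rw [← Multiset.cons_zero, numer_cons, numer_zero, denom_zero]
  ring

theorem denom_singleton (K a : ℂ) : denom K {a} = 1 := by
  rw [← Multiset.cons_zero, denom_cons, numer_zero, denom_zero]
  ring

/-- The quotients `numer / denom` solve the functional equation
`z (x + y) = x y + K²` along sums. -/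
theorem quotient_relation {K : ℂ} {s t : Multiset ℂ} (hs : denom K s ≠ 0) (ht : denom K t ≠ 0)
    (hst : denom K (s + t) ≠ 0) :
    numer K (s + t) / denom K (s + t) * (numer K s / denom K s + numer K t / denom K t) =
      numer K s / denom K s * (numer K t / denom K t) + K ^ 2 := by
  obtain ⟨h1, h2⟩ := numer_denom_add K s t
  have h3 : numer K s / denom K s + numer K t / denom K t =
      denom K (s + t) / (denom K s * denom K t) := by
    rw [h2]; field_simp
    ring
  rw [h3, div_mul_div_cancel₀ hst, h1]
  field_simp

/-- The functional equation determines the value on `s + {a}` from those on `s` and `{a}`. -/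
theorem eq_quotient_of_relation {K a z : ℂ} {s : Multiset ℂ} (hs : denom K s ≠ 0)
    (has : denom K (s + {a}) ≠ 0)
    (h : z * (numer K s / denom K s + a) = numer K s / denom K s * a + K ^ 2) :
    z = numer K (s + {a}) / denom K (s + {a}) := by
  rw [eq_div_iff has]
  obtain ⟨h1, h2⟩ := numer_denom_add K s {a}
  rw [h1, h2, numer_singleton, denom_singleton]
  field_simp at h
  linear_combination h

/-! ### Polynomial dependence on the values, and a point where no denominator vanishes -/

section Polynomials

variable {ι : Type*}

/-- Numerators and denominators are polynomial functions of the values. -/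
theorem exists_polynomial_numer_denom (K : ℂ) (s : Multiset ι) :
    ∃ p q : MvPolynomial ι ℂ, ∀ c : ι → ℂ,
      MvPolynomial.eval c p = numer K (s.map c) ∧ MvPolynomial.eval c q = denom K (s.map c) := by
  induction s using Multiset.induction_on with
  | empty => exact ⟨1, 0, by simp [numer_zero, denom_zero]⟩
  | cons a s ih =>
    obtain ⟨p, q, h⟩ := ih
    refine ⟨MvPolynomial.X a * p + MvPolynomial.C (K ^ 2) * q, MvPolynomial.X a * q + p, ?_⟩
    intro c
    simp [numer_cons, denom_cons, (h c).1, (h c).2]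

/-- A constant point at which no coordinate and no denominator vanishes. -/
theorem exists_denom_replicate_ne_zero (K : ℂ) :
    ∃ t : ℂ, t ≠ 0 ∧ ∀ n : ℕ, n ≠ 0 → denom K (Multiset.replicate n t) ≠ 0 := by
  by_cases hK : K = 0
  · subst hK
    have key : ∀ n : ℕ, numer 0 (Multiset.replicate n 1) = 1 ∧
        denom 0 (Multiset.replicate n 1) = n := by
      intro n
      induction n with
      | zero => simp [numer_zero, denom_zero]
      | succ n ih => simp [Multiset.replicate_succ, numer_cons, denom_cons, ih.1, ih.2]
    exact ⟨1, one_ne_zero, fun n hn => by rw [(key n).2]; exact_mod_cast hn⟩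
  -- With all `cᵢ = K` one has `N + K D = (2K)^n` and `N - K D = 0`, so `D` is a nonzero multiple of
  -- a power of `K`.
  · have key : ∀ n : ℕ, numer K (Multiset.replicate (n + 1) K) = 2 ^ n * K ^ (n + 1) ∧
        denom K (Multiset.replicate (n + 1) K) = 2 ^ n * K ^ n := by
      intro n
      induction n with
      | zero => simp [numer_singleton, denom_singleton]
      | succ n ih =>
        rw [Multiset.replicate_succ, numer_cons, denom_cons, ih.1, ih.2]
        constructor <;> ring
    refine ⟨K, hK, fun n hn => ?_⟩
    obtain ⟨m, rfl⟩ := Nat.exists_eq_succ_of_ne_zero hn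
    rw [Nat.succ_eq_add_one, (key m).2]
    exact mul_ne_zero (pow_ne_zero _ two_ne_zero) (pow_ne_zero _ hK)

end Polynomials

/-! ### Detecting multivectors by dual bases -/

section Detect

variable {V ι : Type*} [AddCommGroup V] [Module ℂ V]

/-- A multivector is zero if it pairs to zero with all products of functionals from a family dual
to a spanning family. -/
theorem multivector_eq_zero_of_pairing {n : ℕ} (e : ι → V) (f : ι → Dual ℂ V)
    (hef : ∀ i, f i (e i) = 1) (hef' : ∀ i j, i ≠ j → f i (e j) = 0)
    (hspan : ⊤ ≤ Submodule.span ℂ (Set.range e)) (w : ⋀[ℂ]^n V)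
    (h : ∀ a : Fin n → ι,
      exteriorPower.pairingDual ℂ V n (exteriorPower.ιMulti ℂ n (f ∘ a)) w = 0) : w = 0 := by
  classical
  let _ : LinearOrder ι := linearOrderOfSTO WellOrderingRel
  have hli : LinearIndependent ℂ e := by
    rw [linearIndependent_iff']
    intro s g hg i hi
    have := congrArg (f i) hg
    rw [map_sum, map_zero, Finset.sum_eq_single i] at this
    · simpa [hef] using this
    · intro j _ hj
      simp [hef' i j hj.symm]
    · exact fun h => absurd hi h
  let B := Basis.mk hli hspan
  have hB : ∀ i, B.coord i = f i := by
    intro i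
    refine B.ext fun j => ?_
    rw [Basis.coord_apply, Basis.repr_self]
    simp only [B, Basis.mk_apply]
    by_cases hij : i = j
    · subst hij; simp [hef]
    · rw [hef' i j hij, Finsupp.single_eq_of_ne hij]
  refine (B.exteriorPower n).ext_elem fun s => ?_
  rw [exteriorPower.basis_repr_apply, map_zero, Finsupp.zero_apply, exteriorPower.ιMultiDual,
    exteriorPower.ιMulti_family]
  convert h _ using 5
  funext k
  exact hB _

end Detect

/-! ### Bivectors as endomorphisms through the Killing form -/

section Contraction

variable {g : Type*} [LieRing g] [LieAlgebra ℂ g]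

/-- The bilinear pairing of a bivector with two elements through the Killing form. -/
def pair₂ (y₁ y₂ : g) : ⋀[ℂ]^2 g →ₗ[ℂ] ℂ :=
  exteriorPower.pairingDual ℂ g 2
    (exteriorPower.ιMulti ℂ 2 ![killingForm ℂ g y₁, killingForm ℂ g y₂])

/-- The pairing of a trivector with three elements through the Killing form. -/
def pair₃ (y₁ y₂ y₃ : g) : ⋀[ℂ]^3 g →ₗ[ℂ] ℂ :=
  exteriorPower.pairingDual ℂ g 3
    (exteriorPower.ιMulti ℂ 3 ![killingForm ℂ g y₁, killingForm ℂ g y₂, killingForm ℂ g y₃])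

theorem pair₂_wedge₂ (y₁ y₂ x₁ x₂ : g) :
    pair₂ y₁ y₂ (wedge₂ x₁ x₂) =
      killingForm ℂ g x₁ y₁ * killingForm ℂ g x₂ y₂ -
        killingForm ℂ g x₂ y₁ * killingForm ℂ g x₁ y₂ := by
  rw [pair₂, wedge₂, exteriorPower.pairingDual_ιMulti_ιMulti, Matrix.det_fin_two]
  simp [LieModule.traceForm_comm ℂ g g x₁, LieModule.traceForm_comm ℂ g g x₂]
  ring

theorem pair₃_wedge₃ (y₁ y₂ y₃ x₁ x₂ x₃ : g) :
    pair₃ y₁ y₂ y₃ (wedge₃ x₁ x₂ x₃) =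
      killingForm ℂ g x₁ y₁ * killingForm ℂ g x₂ y₂ * killingForm ℂ g x₃ y₃
      - killingForm ℂ g x₁ y₁ * killingForm ℂ g x₃ y₂ * killingForm ℂ g x₂ y₃
      - killingForm ℂ g x₂ y₁ * killingForm ℂ g x₁ y₂ * killingForm ℂ g x₃ y₃
      + killingForm ℂ g x₂ y₁ * killingForm ℂ g x₃ y₂ * killingForm ℂ g x₁ y₃
      + killingForm ℂ g x₃ y₁ * killingForm ℂ g x₁ y₂ * killingForm ℂ g x₂ y₃
      - killingForm ℂ g x₃ y₁ * killingForm ℂ g x₂ y₂ * killingForm ℂ g x₁ y₃ := by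
  rw [pair₃, wedge₃, exteriorPower.pairingDual_ιMulti_ιMulti, Matrix.det_fin_three]
  simp [LieModule.traceForm_comm ℂ g g x₁, LieModule.traceForm_comm ℂ g g x₂,
    LieModule.traceForm_comm ℂ g g x₃]
  ring

/-- The contraction of a bivector with the Killing form, as an endomorphism:
`x₁ ∧ x₂` sends `y` to `(x₁, y) x₂ - (x₂, y) x₁`. -/
def contract : ⋀[ℂ]^2 g →ₗ[ℂ] (g →ₗ[ℂ] g) :=
  liftBilin
    (LinearMap.mk₂ ℂ (fun x₁ x₂ => (killingForm ℂ g x₁).smulRight x₂ -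
        (killingForm ℂ g x₂).smulRight x₁)
      (by intros; ext; simp [add_smul]; abel)
      (by intros; ext; simp; module)
      (by intros; ext; simp [add_smul]; abel)
      (by intros; ext; simp; module))
    (by intro x; simp)

theorem contract_wedge₂ (x₁ x₂ y : g) :
    contract (wedge₂ x₁ x₂) y = killingForm ℂ g x₁ y • x₂ - killingForm ℂ g x₂ y • x₁ := by
  simp [contract, liftBilin_wedge₂]

theorem pair₂_eq_contract (v : ⋀[ℂ]^2 g) (y₁ y₂ : g) :
    pair₂ y₁ y₂ v = killingForm ℂ g (contract v y₁) y₂ := by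
  have : pair₂ y₁ y₂ = ((killingForm ℂ g).flip y₂ ∘ₗ LinearMap.applyₗ y₁) ∘ₗ contract := by
    refine bivector_hom_ext fun x₁ x₂ => ?_
    simp [pair₂_wedge₂, contract_wedge₂]
  rw [this]
  rfl

/-- Invariance of the Killing form makes `contract` equivariant, so a bivector is killed by `x` once
its endomorphism commutes with `ad x` and `contract` is known to be injective. -/
theorem contract_adBivector (x : g) (v : ⋀[ℂ]^2 g) (y : g) :
    contract (adBivector x v) y = ⁅x, contract v y⁆ - contract v ⁅x, y⁆ := by
  have key : (LinearMap.applyₗ y ∘ₗ contract) ∘ₗ adBivector x =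
      (LieAlgebra.ad ℂ g x : g →ₗ[ℂ] g) ∘ₗ LinearMap.applyₗ y ∘ₗ contract -
        LinearMap.applyₗ ⁅x, y⁆ ∘ₗ contract := by
    refine bivector_hom_ext fun a b => ?_
    have h : ∀ a, killingForm ℂ g ⁅x, a⁆ y = -killingForm ℂ g a ⁅x, y⁆ := by
      intro a
      rw [← lie_skew, map_neg, LinearMap.neg_apply, LieModule.traceForm_apply_lie_apply]
    simp [adBivector, liftBilin_wedge₂, contract_wedge₂, h]
    abel
  exact LinearMap.congr_fun key v

/-- The Schouten bracket in terms of contractions. -/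
theorem pair₃_schouten (v w : ⋀[ℂ]^2 g) (y₁ y₂ y₃ : g) :
    pair₃ y₁ y₂ y₃ (schouten v w) =
      (killingForm ℂ g ⁅contract v y₁, contract w y₂⁆ y₃ -
        killingForm ℂ g ⁅contract v y₂, contract w y₁⁆ y₃) +
      (killingForm ℂ g ⁅contract v y₂, contract w y₃⁆ y₁ -
        killingForm ℂ g ⁅contract v y₃, contract w y₂⁆ y₁) +
      (killingForm ℂ g ⁅contract v y₃, contract w y₁⁆ y₂ -
        killingForm ℂ g ⁅contract v y₁, contract w y₃⁆ y₂) := by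
  -- Both sides are bilinear in `v` and `w`, so the identity need only be checked on decomposable
  -- bivectors.
  let F : g → g → g → ⋀[ℂ]^2 g →ₗ[ℂ] ⋀[ℂ]^2 g →ₗ[ℂ] ℂ := fun a b c =>
    (LinearMap.mk₂ ℂ (fun x y => killingForm ℂ g ⁅x, y⁆ c) (by simp) (by simp) (by simp)
      (by simp)).compl₁₂ (LinearMap.applyₗ a ∘ₗ contract) (LinearMap.applyₗ b ∘ₗ contract)
  have hF : ∀ a b c v w, F a b c v w = killingForm ℂ g ⁅contract v a, contract w b⁆ c :=
    fun a b c v w => rfl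
  have key : schouten.compr₂ (pair₃ y₁ y₂ y₃) = (F y₁ y₂ y₃ - F y₂ y₁ y₃) +
      (F y₂ y₃ y₁ - F y₃ y₂ y₁) + (F y₃ y₁ y₂ - F y₁ y₃ y₂) := by
    refine bivector_hom_ext fun x₁ x₂ => bivector_hom_ext fun x₃ x₄ => ?_
    simp only [LinearMap.compr₂_apply, schouten_wedge₂, schoutenDecomp, map_add, map_sub,
      pair₃_wedge₃, LinearMap.add_apply, LinearMap.sub_apply, hF, contract_wedge₂, lie_sub,
      sub_lie, lie_smul, smul_lie, map_smul, LinearMap.smul_apply, smul_eq_mul]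
    ring
  exact LinearMap.congr_fun₂ key v w

/-- The trilinear form `([a, b], c)` is totally antisymmetric, so on eigenvectors the six terms of
`pair₃_schouten` collapse to one structure constant. -/
theorem pair₃_schouten_of_eigen {v : ⋀[ℂ]^2 g} {y₁ y₂ y₃ : g} {t₁ t₂ t₃ : ℂ}
    (h₁ : contract v y₁ = t₁ • y₁) (h₂ : contract v y₂ = t₂ • y₂) (h₃ : contract v y₃ = t₃ • y₃) :
    pair₃ y₁ y₂ y₃ (schouten v v) =
      2 * (t₁ * t₂ + t₂ * t₃ + t₃ * t₁) * killingForm ℂ g ⁅y₁, y₂⁆ y₃ := by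
  have hskew : ∀ a c e : g, killingForm ℂ g ⁅a, c⁆ e = -killingForm ℂ g ⁅c, a⁆ e := by
    intro a c e
    rw [← lie_skew, map_neg, LinearMap.neg_apply]
  have hcyc : ∀ a c e : g, killingForm ℂ g ⁅a, c⁆ e = killingForm ℂ g ⁅c, e⁆ a := by
    intro a c e
    rw [LieModule.traceForm_apply_lie_apply, LieModule.traceForm_comm]
  rw [pair₃_schouten, h₁, h₂, h₃]
  simp only [smul_lie, lie_smul, map_smul, LinearMap.smul_apply, smul_eq_mul]
  rw [hskew y₂ y₁, hskew y₃ y₂, hskew y₁ y₃, hcyc y₃ y₁ y₂, hcyc y₂ y₃ y₁, hcyc y₃ y₁ y₂]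
  ring

end Contraction

/-! ### Roots and root vectors -/

section Roots

variable {g : Type*} [LieRing g] [LieAlgebra ℂ g] [FiniteDimensional ℂ g]
  [LieAlgebra.IsKilling ℂ g]
  {H : LieSubalgebra ℂ g} [H.IsCartanSubalgebra]

/-- The negative of a root. -/
def negRoot (α : H.root) : H.root :=
  ⟨-α.1, by simpa using (LieSubalgebra.isNonZero_coe_root α)⟩

theorem root_negRoot (α : H.root) : (rootSystem H).root (negRoot α) = -(rootSystem H).root α := by
  rfl

theorem negRoot_negRoot (α : H.root) : negRoot (negRoot α) = α := by
  apply Subtype.ext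
  simp [negRoot]

theorem isPos_negRoot_iff (b : (rootSystem H).Base) (α : H.root) :
    b.IsPos (negRoot α) ↔ ¬ b.IsPos α := by
  rw [← RootPairing.Base.IsPos.neg_iff_not b α]
  have : negRoot α = (rootSystem H).reflectionPerm α α := by
    apply (rootSystem H).root.injective
    rw [root_negRoot, RootPairing.root_reflectionPerm, RootPairing.reflection_apply_self]
  rw [this]
  rfl

theorem root_ext {α β : H.root} (h : (rootSystem H).root α = (rootSystem H).root β) : α = β :=
  (rootSystem H).root.injective h

theorem coe_weight_eq_add {α β γ : H.root}
    (h : (rootSystem H).root γ = (rootSystem H).root α + (rootSystem H).root β) :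
    (γ.1 : H → ℂ) = (α.1 : H → ℂ) + (β.1 : H → ℂ) := by
  funext x
  exact LinearMap.congr_fun h x

theorem exists_smul_of_mem_rootSpace (α : H.root) {x y : g}
    (hx : x ∈ LieAlgebra.rootSpace H α.1) (hx0 : x ≠ 0) (hy : y ∈ LieAlgebra.rootSpace H α.1) :
    ∃ t : ℂ, y = t • x := by
  obtain ⟨c, hc⟩ := (finrank_eq_one_iff_of_nonzero' (⟨x, hx⟩ : LieAlgebra.rootSpace H α.1)
    (by simpa using hx0)).mp
      (finrank_rootSpace_eq_one α.1 (LieSubalgebra.isNonZero_coe_root α)) ⟨y, hy⟩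
  exact ⟨c, by simpa using (congrArg Subtype.val hc).symm⟩

/-- The bracket of root vectors for `α` and `β` is nonzero when `α + β` is a root. -/
theorem lie_ne_zero_of_root_add {α β γ : H.root}
    (h : (rootSystem H).root γ = (rootSystem H).root α + (rootSystem H).root β)
    {x y : g} (hx : x ∈ LieAlgebra.rootSpace H α.1) (hx0 : x ≠ 0)
    (hy : y ∈ LieAlgebra.rootSpace H β.1) (hy0 : y ≠ 0) : ⁅x, y⁆ ≠ 0 := by
  have hα : (-α.1).IsNonZero := by simpa using LieSubalgebra.isNonZero_coe_root α
  -- The `sl₂`-triple is taken for `-α`, so that `f` has weight `α`. A vector `z` at the top of the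
  -- `-α`-chain through `β` is then primitive, and `p` applications of `f` bring it back to weight
  -- `β`.
  obtain ⟨z, hz, z_ne0⟩ := (LieModule.chainTop (-α.1 : LieModule.Weight ℂ H g) β.1).exists_ne_zero
  obtain ⟨k, e, f, isSl2, he, hf⟩ := exists_isSl2Triple_of_weight_isNonZero hα
  obtain rfl := isSl2.h_eq_coroot hα he hf
  have prim : isSl2.HasPrimitiveVectorWith z (chainLength (-α.1) β.1 : ℂ) :=
    have := LieAlgebra.lie_mem_genWeightSpace_of_mem_genWeightSpace he hz
    ⟨z_ne0, (chainLength_smul _ _ hz).symm,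
      by rwa [LieModule.genWeightSpace_add_chainTop _ _ hα] at this⟩
  have hf' : f ∈ LieAlgebra.rootSpace H α.1 := by
    simpa using hf
  set p := LieModule.chainTopCoeff (-α.1 : LieModule.Weight ℂ H g) β.1 with hp
  -- As `α + β` is a root, the chain continues at least one step beyond `β`. Hence `f^{p+1} z ≠ 0`,
  -- and by one-dimensionality this vector is a multiple of `⁅x, y⁆`.
  have hlen : p + 1 ≤ chainLength (-α.1) β.1 := by
    rw [← chainTopCoeff_add_chainBotCoeff]
    have h1 := (rootSpace_zsmul_add_ne_bot_iff (-α.1) β.1 hα (-1)).1 (by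
      have : ((-1 : ℤ) • ((-α.1 : LieModule.Weight ℂ H g) : H → ℂ) + (β.1 : H → ℂ)) = γ.1 := by
        rw [coe_weight_eq_add h]; simp
      rw [this]
      exact γ.1.genWeightSpace_ne_bot)
    have h2 := h1.2
    simp only [neg_neg] at h2
    rw [← hp]
    have h3 : 1 ≤ LieModule.chainBotCoeff (-α.1 : LieModule.Weight ℂ H g) β.1 := by
      exact_mod_cast h2
    omega
  have hmem := LieAlgebra.toEnd_pow_apply_mem hf' hz p
  have hwt : (p • (α.1 : H → ℂ) +
      (LieModule.chainTop (-α.1 : LieModule.Weight ℂ H g) β.1 : H → ℂ)) = β.1 := by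
    rw [LieModule.coe_chainTop', ← hp]
    simp
  rw [hwt] at hmem
  have hne := prim.pow_toEnd_f_ne_zero_of_eq_nat rfl (show p ≤ _ by omega)
  have hne' := prim.pow_toEnd_f_ne_zero_of_eq_nat rfl hlen
  rw [pow_succ', Module.End.mul_apply, LieModule.toEnd_apply_apply] at hne'
  obtain ⟨s, hs⟩ := exists_smul_of_mem_rootSpace α hx hx0 hf'
  obtain ⟨t, ht⟩ := exists_smul_of_mem_rootSpace β hy hy0 hmem
  rw [ht, hs, smul_lie, lie_smul] at hne'
  intro h0
  rw [h0] at hne'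
  simp at hne'

variable {E : LieModule.Weight ℂ H g → g}

theorem IsRootVectors.mem_root (hE : IsRootVectors E) (α : H.root) :
    E α.1 ∈ LieAlgebra.rootSpace H α.1 := hE.mem _ (LieSubalgebra.isNonZero_coe_root α)

theorem IsRootVectors.killing_neg (hE : IsRootVectors E) (α : H.root) :
    killingForm ℂ g (E α.1) (E (negRoot α).1) = 1 :=
  hE.killing _ (LieSubalgebra.isNonZero_coe_root α)

theorem IsRootVectors.ne_zero (hE : IsRootVectors E) (α : H.root) : E α.1 ≠ 0 := by
  intro h
  have := hE.killing_neg α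
  rw [h] at this
  simp at this

theorem killing_root_eq_zero {α : H.root} {x : g} {μ : Dual ℂ H} {e : g}
    (he : e ∈ LieAlgebra.rootSpace H α.1) (hx : x ∈ LieAlgebra.rootSpace H μ)
    (h : (rootSystem H).root α + μ ≠ 0) : killingForm ℂ g e x = 0 := by
  refine LieAlgebra.killingForm_apply_eq_zero_of_mem_rootSpace_of_add_ne_zero ℂ g H he hx ?_
  intro h0
  apply h
  ext y
  exact congrFun h0 y

theorem IsRootVectors.killing_eq_zero (hE : IsRootVectors E) {α β : H.root}
    (h : β ≠ negRoot α) : killingForm ℂ g (E α.1) (E β.1) = 0 := by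
  refine killing_root_eq_zero (μ := (rootSystem H).root β) (hE.mem_root α) (hE.mem_root β) ?_
  intro h0
  apply h
  apply root_ext
  rw [root_negRoot, eq_neg_iff_add_eq_zero, add_comm, h0]

theorem IsRootVectors.exists_smul (hE : IsRootVectors E) (α : H.root) {y : g}
    (hy : y ∈ LieAlgebra.rootSpace H α.1) : ∃ t : ℂ, y = t • E α.1 :=
  exists_smul_of_mem_rootSpace α (hE.mem_root α) (hE.ne_zero α) hy

/-- A nonzero root space is that of `0` or of a root. -/
theorem rootSpace_cases (μ : Dual ℂ H) {x : g} (hx : x ∈ LieAlgebra.rootSpace H μ) :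
    x = 0 ∨ (μ = 0 ∧ x ∈ H) ∨ ∃ α : H.root, (rootSystem H).root α = μ ∧
      x ∈ LieAlgebra.rootSpace H α.1 := by
  by_cases h0 : x = 0
  · exact Or.inl h0
  right
  by_cases hμ : μ = 0
  · refine Or.inl ⟨hμ, ?_⟩
    subst hμ
    have : x ∈ LieAlgebra.rootSpace H (0 : H → ℂ) := hx
    rw [LieAlgebra.rootSpace_zero_eq] at this
    simpa using this
  · right
    let W : LieModule.Weight ℂ H g := ⟨μ, fun h => h0 (by
      have hx' : x ∈ LieModule.genWeightSpace g (μ : H → ℂ) := hx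
      rw [h] at hx'
      simpa using hx')⟩
    have hW : W.IsNonZero := by
      intro h
      apply hμ
      ext y
      exact congrFun h y
    refine ⟨⟨W, by simpa using hW⟩, ?_, hx⟩
    ext y
    rfl

omit [LieAlgebra.IsKilling ℂ g] in
theorem mem_rootSpace_zero {x : g} (hx : x ∈ H) :
    x ∈ LieAlgebra.rootSpace H ((0 : Dual ℂ H) : H → ℂ) := by
  change x ∈ LieAlgebra.rootSpace H (0 : H → ℂ)
  rw [LieAlgebra.rootSpace_zero_eq]
  simpa using hx

omit [FiniteDimensional ℂ g] [LieAlgebra.IsKilling ℂ g] in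
theorem lie_mem_rootSpace {x y : g} {μ ν : Dual ℂ H} (hx : x ∈ LieAlgebra.rootSpace H μ)
    (hy : y ∈ LieAlgebra.rootSpace H ν) :
    ⁅x, y⁆ ∈ LieAlgebra.rootSpace H ((μ + ν : Dual ℂ H) : H → ℂ) :=
  LieAlgebra.lie_mem_genWeightSpace_of_mem_genWeightSpace hx hy

theorem IsRootVectors.mem_root' (hE : IsRootVectors E) (α : H.root) :
    E α.1 ∈ LieAlgebra.rootSpace H ((rootSystem H).root α : Dual ℂ H) := hE.mem_root α

/-- A Lie algebra is spanned by its Cartan subalgebra and the root vectors. -/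
theorem IsRootVectors.span_eq_top (hE : IsRootVectors E) :
    H.toSubmodule ⊔ Submodule.span ℂ (Set.range fun α : H.root => E α.1) = ⊤ := by
  have h := congrArg LieSubmodule.toSubmodule (LieAlgebra.cartan_sup_iSup_rootSpace_eq_top (K := ℂ) H)
  rw [LieSubmodule.sup_toSubmodule] at h
  rw [eq_top_iff, ← LieSubmodule.top_toSubmodule (R := ℂ) (L := H), ← h]
  refine sup_le_sup le_rfl ?_
  simp only [LieSubmodule.iSup_toSubmodule]
  refine iSup_le fun α => iSup_le fun hα => ?_
  intro x hx
  obtain ⟨t, rfl⟩ := hE.exists_smul ⟨α, by simpa using hα⟩ hx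
  exact Submodule.smul_mem _ _ (Submodule.subset_span ⟨⟨α, by simpa using hα⟩, rfl⟩)

end Roots

/-! ### Quasiroots -/

section Quasiroots

variable {g : Type*} [LieRing g] [LieAlgebra ℂ g] [FiniteDimensional ℂ g]
  [LieAlgebra.IsKilling ℂ g]
  {H : LieSubalgebra ℂ g} [H.IsCartanSubalgebra]
  {b : (rootSystem H).Base} {Γ : Set H.root}

theorem isOutside_iff (α : H.root) : IsOutside Γ α ↔ bar Γ α ≠ 0 := by
  simp [IsOutside, bar]

theorem bar_add {α β γ : H.root}
    (h : (rootSystem H).root γ = (rootSystem H).root α + (rootSystem H).root β) :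
    bar Γ γ = bar Γ α + bar Γ β := by
  simp only [bar, h, map_add]

theorem bar_negRoot (α : H.root) : bar Γ (negRoot α) = -bar Γ α := by
  simp only [bar, root_negRoot, map_neg]

theorem bar_eq_zero_of_mem {α : H.root} (h : α ∈ Γ) : bar Γ α = 0 := by
  have : (rootSystem H).root α ∈ hGamma Γ := Submodule.subset_span ⟨α, h, rfl⟩
  simpa [bar] using this

theorem isOutside_negRoot {α : H.root} : IsOutside Γ (negRoot α) ↔ IsOutside Γ α := by
  simp [isOutside_iff, bar_negRoot]

theorem sum_decomposition (hΓ : Γ ⊆ b.support) (q : PosQuasiroot b Γ) :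
    ((decomposition hΓ q).map fun i => (simpleQuasiroot hΓ i).1).sum = q.1 :=
  (existsUnique_decomposition hΓ q).choose_spec.1

theorem eq_decomposition (hΓ : Γ ⊆ b.support) (q : PosQuasiroot b Γ)
    {s : Multiset (SimpleOutside b Γ)}
    (h : (s.map fun i => (simpleQuasiroot hΓ i).1).sum = q.1) : s = decomposition hΓ q :=
  (existsUnique_decomposition hΓ q).choose_spec.2 s h

theorem decomposition_simple (hΓ : Γ ⊆ b.support) (i : SimpleOutside b Γ) :
    decomposition hΓ (simpleQuasiroot hΓ i) = {i} :=
  (eq_decomposition hΓ _ (by simp)).symm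

theorem decomposition_add (hΓ : Γ ⊆ b.support) {p q r : PosQuasiroot b Γ}
    (h : r.1 = p.1 + q.1) :
    decomposition hΓ r = decomposition hΓ p + decomposition hΓ q :=
  (eq_decomposition hΓ _ (by simp [sum_decomposition, h])).symm

theorem decomposition_ne_zero (hΓ : Γ ⊆ b.support) (q : PosQuasiroot b Γ) :
    decomposition hΓ q ≠ 0 := by
  intro h
  have := sum_decomposition hΓ q
  rw [h] at this
  exact q.2.1 (by simpa using this.symm)

/-- If `p = -q`, then `q = q + (p + q)` gives a second decomposition of `q` into simple quasiroots;
uniqueness makes that of `p + q` empty, hence that of `q` too. -/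
theorem PosQuasiroot.not_neg (hΓ : Γ ⊆ b.support) (p q : PosQuasiroot b Γ) : p.1 ≠ -q.1 := by
  intro h
  have h1 : decomposition hΓ q + (decomposition hΓ p + decomposition hΓ q) =
      decomposition hΓ q := eq_decomposition hΓ q (by simp [sum_decomposition, h])
  have h2 : decomposition hΓ p + decomposition hΓ q = 0 := by
    simpa using h1
  exact decomposition_ne_zero hΓ q (add_eq_zero.1 h2).2

/-- Positivity of a root outside `Ω_Γ` only depends on its quasiroot. -/
theorem isPos_of_bar_eq (hΓ : Γ ⊆ b.support) {α : H.root} (p : PosQuasiroot b Γ)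
    (h : bar Γ α = p.1) : b.IsPos α := by
  by_contra hα
  have hα' := (isPos_negRoot_iff b α).2 hα
  refine PosQuasiroot.not_neg hΓ ⟨-p.1, by simpa using p.2.1, negRoot α, hα', ?_⟩ p rfl
  rw [bar_negRoot, h]

/-- Induction over `Ω⁺ ∖ Ω_Γ`, through the positive quasiroots, by adding simple quasiroots. -/
theorem posQuasiroot_induction (hΓ : Γ ⊆ b.support) {P : PosQuasiroot b Γ → Prop}
    (simple : ∀ i, P (simpleQuasiroot hΓ i))
    (step : ∀ (α : PosOutside b Γ) (i : SimpleOutside b Γ) (γ : PosOutside b Γ),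
      (rootSystem H).root γ.1 = (rootSystem H).root α.1 + (rootSystem H).root i.1 →
      P α.bar → P γ.bar) (q : PosQuasiroot b Γ) : P q := by
  obtain ⟨q, hq, α, hα, rfl⟩ := q
  have key : ∀ h : bar Γ α ≠ 0 ∧ ∃ β : H.root, b.IsPos β ∧ bar Γ β = bar Γ α, P ⟨bar Γ α, h⟩ := by
    clear hq
    refine RootPairing.Base.IsPos.induction_on_add (b := b) hα (p := fun α =>
      ∀ h : bar Γ α ≠ 0 ∧ ∃ β : H.root, b.IsPos β ∧ bar Γ β = bar Γ α, P ⟨bar Γ α, h⟩) ?_ ?_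
    · intro i hi h
      by_cases hiΓ : i ∈ Γ
      · exact absurd (bar_eq_zero_of_mem hiΓ) h.1
      · exact simple ⟨i, hi, hiΓ⟩
    · intro i j k hijk ih hj h
      have hk : bar Γ k = bar Γ i + bar Γ j := bar_add hijk
      have hkpos : b.IsPos k := isPos_of_bar_eq hΓ ⟨_, h⟩ rfl
      -- Adding a root of `Γ` leaves the quasiroot unchanged, and if `ī = 0` the quasiroot of `k` is
      -- simple; only the remaining case is a genuine step.
      by_cases hjΓ : j ∈ Γ
      · have hki : bar Γ i = bar Γ k := by rw [hk, bar_eq_zero_of_mem hjΓ, add_zero]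
        have := ih (by rw [hki]; exact h)
        simpa only [hki] using this
      · by_cases hi0 : bar Γ i = 0
        · have hkj : bar Γ j = bar Γ k := by rw [hk, hi0, zero_add]
          have := simple ⟨j, hj, hjΓ⟩
          simp only [simpleQuasiroot, SimpleOutside.toPosOutside, PosOutside.bar] at this
          simpa only [hkj] using this
        · have hjpos := b.isPos_of_mem_support hj
          -- The induction principle does not supply positivity of `i`. It follows from heights: `k`
          -- has positive height, `j` has height `1`, and the height of a root is never zero.
          have hipos : b.IsPos i := by
            by_contra hneg
            have hneg' := (isPos_negRoot_iff b i).2 hneg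
            have h1 := b.height_add hijk
            have h2 : b.height j = 1 := b.height_one_of_mem_support hj
            rw [RootPairing.Base.isPos_iff] at hneg hkpos
            have h3 := b.height_ne_zero i
            omega
          exact step ⟨i, hipos, (isOutside_iff i).2 hi0⟩ ⟨j, hj, hjΓ⟩
            ⟨k, hkpos, (isOutside_iff k).2 h.1⟩ hijk (ih ⟨hi0, i, hipos, rfl⟩)
  exact key _

instance : Finite (PosQuasiroot b Γ) := by
  have : Finite (Set.range fun α : H.root => bar Γ α) := inferInstance
  refine Finite.of_injective (β := Set.range fun α : H.root => bar Γ α)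
    (fun q => ⟨q.1, q.2.2.choose, q.2.2.choose_spec.2⟩) ?_
  intro p q h
  exact Subtype.ext (Subtype.mk.inj h)

end Quasiroots

section Levi

variable {g : Type*} [LieRing g] [LieAlgebra ℂ g] [FiniteDimensional ℂ g]
  [LieAlgebra.IsKilling ℂ g]
  {H : LieSubalgebra ℂ g} [H.IsCartanSubalgebra]
  {b : (rootSystem H).Base} {Γ : Set H.root} {E : LieModule.Weight ℂ H g → g}

/-! ### The Levi subalgebra and its complement -/

/-- A subalgebra which contains all root spaces for weights in `h*_Γ` contains `g_Γ`. -/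
theorem levi_le (hE : IsRootVectors E) {S : LieSubalgebra ℂ g}
    (h : ∀ μ ∈ hGamma Γ, ∀ x ∈ LieAlgebra.rootSpace H (μ : Dual ℂ H), x ∈ S) :
    levi E Γ ≤ S := by
  refine LieSubalgebra.lieSpan_le.2 ?_
  rintro x (hx | ⟨α, hα, hx⟩)
  · exact h 0 (Submodule.zero_mem _) x (mem_rootSpace_zero hx)
  · have hm : (rootSystem H).root α ∈ hGamma Γ := Submodule.subset_span ⟨α, hα, rfl⟩
    rcases hx with rfl | rfl
    · exact h _ hm _ (hE.mem_root' α)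
    · exact h _ ((hGamma Γ).neg_mem hm) _ (hE.mem_root' (negRoot α))

theorem cartan_le_levi {x : g} (hx : x ∈ H) : x ∈ levi E Γ :=
  LieSubalgebra.subset_lieSpan (Or.inl hx)

/-- The bracket of `E_α` and `E_β` is nonzero and lies in the line spanned by `E_γ`. -/
theorem rootVector_mem_levi_of_add (hE : IsRootVectors E) {α β γ : H.root}
    (h : (rootSystem H).root γ = (rootSystem H).root α + (rootSystem H).root β)
    (hα : E α.1 ∈ levi E Γ) (hβ : E β.1 ∈ levi E Γ) : E γ.1 ∈ levi E Γ := by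
  have h1 := lie_ne_zero_of_root_add h (hE.mem_root α) (hE.ne_zero α) (hE.mem_root β) (hE.ne_zero β)
  have h2 := lie_mem_rootSpace (hE.mem_root' α) (hE.mem_root' β)
  rw [← h] at h2
  obtain ⟨t, ht⟩ := exists_smul_of_mem_rootSpace γ h2 h1 (hE.mem_root γ)
  rw [ht]
  exact (levi E Γ).smul_mem _ ((levi E Γ).lie_mem hα hβ)

/-- `g_Γ` contains the root vectors for `Ω_Γ`. -/
theorem rootVector_mem_levi (hE : IsRootVectors E) (hΓ : Γ ⊆ b.support) (α : H.root)
    (hα : bar Γ α = 0) : E α.1 ∈ levi E Γ := by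
  have key : ∀ α : H.root, b.IsPos α → bar Γ α = 0 →
      E α.1 ∈ levi E Γ ∧ E (negRoot α).1 ∈ levi E Γ := by
    have gen : ∀ i ∈ Γ, E i.1 ∈ levi E Γ ∧ E (negRoot i).1 ∈ levi E Γ := fun i hi =>
      ⟨LieSubalgebra.subset_lieSpan (Or.inr ⟨i, hi, Or.inl rfl⟩),
        LieSubalgebra.subset_lieSpan (Or.inr ⟨i, hi, Or.inr rfl⟩)⟩
    intro α hα
    refine (RootPairing.Base.IsPos.induction_on_add (b := b) hα (p := fun α => b.IsPos α ∧
      (bar Γ α = 0 → E α.1 ∈ levi E Γ ∧ E (negRoot α).1 ∈ levi E Γ)) ?_ ?_).2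
    · refine fun i hi => ⟨b.isPos_of_mem_support hi, fun h0 => ?_⟩
      by_cases hiΓ : i ∈ Γ
      · exact gen i hiΓ
      · exact absurd h0 ((isOutside_iff i).1 (simple_isOutside hΓ ⟨i, hi, hiΓ⟩))
    · refine fun i j k hijk ⟨hi, ih⟩ hj => ⟨hi.add (b.isPos_of_mem_support hj) hijk, fun hk => ?_⟩
      rw [bar_add hijk] at hk
      -- Otherwise `-ī = j̄` would be a positive quasiroot, forcing `-i` to be positive together
      -- with `i`.
      have hjΓ : j ∈ Γ := by
        by_contra hjΓ
        have hij : bar Γ (negRoot i) = (simpleQuasiroot hΓ ⟨j, hj, hjΓ⟩).1 := by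
          rw [bar_negRoot, neg_eq_iff_add_eq_zero]
          exact hk
        have h1 := isPos_of_bar_eq hΓ _ hij
        rw [isPos_negRoot_iff] at h1
        exact h1 hi
      have hj0 := bar_eq_zero_of_mem hjΓ
      obtain ⟨h1, h2⟩ := ih (by simpa [hj0] using hk)
      obtain ⟨h3, h4⟩ := gen j hjΓ
      refine ⟨rootVector_mem_levi_of_add hE hijk h1 h3, rootVector_mem_levi_of_add hE ?_ h2 h4⟩
      simp only [root_negRoot, hijk]
      abel
  by_cases hpos : b.IsPos α
  · exact (key α hpos hα).1
  · have h := (key (negRoot α) ((isPos_negRoot_iff b α).2 hpos)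
      (by rw [bar_negRoot, hα, neg_zero])).2
    rwa [negRoot_negRoot] at h

theorem root_add_notMem_hGamma {μ : Dual ℂ H} (hμ : μ ∈ hGamma Γ) {γ : H.root} (hγ : IsOutside Γ γ) :
    (rootSystem H).root γ + μ ∉ hGamma Γ := by
  intro h
  exact hγ (((hGamma Γ).add_mem_iff_left hμ).1 h)

/-- `g_Γ` normalizes `m` and is orthogonal to it. -/
theorem levi_normalizes (hE : IsRootVectors E) {x : g} (hx : x ∈ levi E Γ) {y : g}
    (hy : y ∈ mGamma E Γ) : ⁅x, y⁆ ∈ mGamma E Γ ∧ killingForm ℂ g x y = 0 := by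
  -- The two properties are proved together: orthogonality of a commutator to `m` uses that its
  -- second factor normalizes `m`.
  let S : LieSubalgebra ℂ g :=
    { carrier := {x | ∀ y ∈ mGamma E Γ, ⁅x, y⁆ ∈ mGamma E Γ ∧ killingForm ℂ g x y = 0}
      add_mem' := fun {a c} ha hc y hy => by
        simpa [add_lie, (ha y hy).2, (hc y hy).2] using add_mem (ha y hy).1 (hc y hy).1
      zero_mem' := fun y _ => by simp
      smul_mem' := fun t a ha y hy => by
        simpa [(ha y hy).2] using (mGamma E Γ).smul_mem t (ha y hy).1
      lie_mem' := fun {a c} ha hc y hy => by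
        constructor
        · rw [lie_lie]
          exact sub_mem (ha _ (hc y hy).1).1 (hc _ (ha y hy).1).1
        · rw [LieModule.traceForm_apply_lie_apply]
          exact (ha _ (hc y hy).1).2 }
  refine levi_le hE (S := S) ?_ hx y hy
  intro μ hμ x hx y hy
  induction hy using Submodule.span_induction with
  | zero => simp
  | add y z _ _ h1 h2 => exact ⟨by rw [lie_add]; exact add_mem h1.1 h2.1, by simp [h1.2, h2.2]⟩
  | smul t y _ h =>
    exact ⟨by rw [lie_smul]; exact (mGamma E Γ).smul_mem t h.1, by simp [h.2]⟩
  | mem y hy =>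
    obtain ⟨γ, hγ, rfl⟩ := hy
    have hne := root_add_notMem_hGamma hμ hγ
    constructor
    · have h := lie_mem_rootSpace hx (hE.mem_root' γ)
      rw [add_comm] at h
      rcases rootSpace_cases _ h with h0 | ⟨h0, -⟩ | ⟨δ, hδ, h0⟩
      · rw [h0]; exact zero_mem _
      · rw [h0] at hne
        exact absurd (zero_mem _) hne
      · obtain ⟨t, ht⟩ := hE.exists_smul δ h0
        rw [ht]
        refine Submodule.smul_mem _ _ (Submodule.subset_span ⟨δ, ?_, rfl⟩)
        rw [IsOutside, hδ]
        exact hne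
    · rw [LieModule.traceForm_comm]
      refine killing_root_eq_zero (hE.mem_root γ) hx fun h0 => ?_
      rw [h0] at hne
      exact absurd (zero_mem _) hne

theorem levi_sup_mGamma (hE : IsRootVectors E) (hΓ : Γ ⊆ b.support) :
    (levi E Γ).toSubmodule ⊔ mGamma E Γ = ⊤ := by
  rw [eq_top_iff, ← hE.span_eq_top, sup_le_iff]
  constructor
  · exact le_sup_of_le_left fun x hx => cartan_le_levi hx
  · rw [Submodule.span_le]
    rintro _ ⟨α, rfl⟩
    by_cases hα : IsOutside Γ α
    · exact Submodule.mem_sup_right (Submodule.subset_span ⟨α, hα, rfl⟩)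
    · rw [isOutside_iff, not_not] at hα
      exact Submodule.mem_sup_left (rootVector_mem_levi hE hΓ α hα)

/-! ### Contractions of diagonal bivectors -/

open Classical in
-- The contraction of `E_α ∧ E_{-α}` sees only `E_α`, which it sends to `-E_α`, and `E_{-α}`, which
-- it fixes. The index set is kept general so as to cover both `bivector` and `rMatrix`.
theorem contract_sum (hE : IsRootVectors E) {p : H.root → Prop} (hp : ∀ α, p α → b.IsPos α)
    {x : Fintype {α // p α}} (c : {α // p α} → ℂ) (γ : H.root) :
    contract (∑ α : {α // p α}, c α • wedge₂ (E α.1.1) (E (-α.1.1))) (E γ.1) =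
      (if h : p γ then -c ⟨γ, h⟩ else if h : p (negRoot γ) then c ⟨negRoot γ, h⟩ else 0) •
        E γ.1 := by
  have hterm : ∀ α : H.root, contract (wedge₂ (E α.1) (E (-α.1))) (E γ.1) =
      killingForm ℂ g (E α.1) (E γ.1) • E (negRoot α).1 -
        killingForm ℂ g (E (negRoot α).1) (E γ.1) • E α.1 := fun α => contract_wedge₂ _ _ _
  have hne : ∀ α : H.root, α ≠ γ → α ≠ negRoot γ →
      contract (wedge₂ (E α.1) (E (-α.1))) (E γ.1) = 0 := by
    intro α h1 h2
    rw [hterm, hE.killing_eq_zero, hE.killing_eq_zero]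
    · simp
    · rw [negRoot_negRoot]; exact h1.symm
    · rintro rfl; exact h2 (negRoot_negRoot α).symm
  have hself : ∀ α : H.root, b.IsPos α → α ≠ negRoot α := by
    intro α hα h
    rw [h, isPos_negRoot_iff] at hα
    have := (isPos_negRoot_iff b α).1
    rw [← h] at this
    by_cases h' : b.IsPos α
    · exact hα h'
    · rw [h, isPos_negRoot_iff] at h'
      exact h' hα
  simp only [map_sum, map_smul, LinearMap.sum_apply, LinearMap.smul_apply]
  by_cases h : p γ
  · rw [dif_pos h, Finset.sum_eq_single ⟨γ, h⟩]
    · rw [hterm, hE.killing_eq_zero (hself γ (hp γ h))]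
      have := hE.killing_neg γ
      rw [LieModule.traceForm_comm] at this
      rw [this]
      simp
    · intro α _ hα
      rw [hne, smul_zero]
      · intro h'; exact hα (Subtype.ext h')
      · intro h'
        have h1 := hp _ α.2
        rw [h', isPos_negRoot_iff] at h1
        exact h1 (hp _ h)
    · simp
  · rw [dif_neg h]
    by_cases h' : p (negRoot γ)
    · rw [dif_pos h', Finset.sum_eq_single ⟨negRoot γ, h'⟩]
      · have h1 := hE.killing_neg γ
        rw [LieModule.traceForm_comm] at h1
        rw [hterm]
        simp only [negRoot_negRoot]
        rw [h1, hE.killing_eq_zero]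
        · simp
        · intro h2
          have h3 := hp _ h'
          rw [← h2] at h3
          have h4 := hp _ h'
          rw [isPos_negRoot_iff] at h4
          exact h4 h3
      · intro α _ hα
        rw [hne, smul_zero]
        · intro h2; exact h (h2 ▸ α.2)
        · intro h2; exact hα (Subtype.ext h2)
      · simp
    · rw [dif_neg h', zero_smul]
      refine Finset.sum_eq_zero fun α _ => ?_
      rw [hne, smul_zero]
      · intro h2; exact h (h2 ▸ α.2)
      · intro h2; exact h' (h2 ▸ α.2)

open Classical in
/-- The eigenvalues of the contraction of `∑ c(ᾱ) E_α ∧ E_{-α}`, as a function on `h*/h*_Γ`. -/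
def eigenvalue (d : PosQuasiroot b Γ → ℂ) (q : Dual ℂ H ⧸ hGamma Γ) : ℂ :=
  if h : q ≠ 0 ∧ ∃ α : H.root, b.IsPos α ∧ bar Γ α = q then -d ⟨q, h⟩
  else if h : -q ≠ 0 ∧ ∃ α : H.root, b.IsPos α ∧ bar Γ α = -q then d ⟨-q, h⟩ else 0

theorem eigenvalue_pos (d : PosQuasiroot b Γ → ℂ) (α : PosOutside b Γ) :
    eigenvalue d (bar Γ α.1) = -d α.bar :=
  dif_pos α.bar.2

theorem eigenvalue_neg (hΓ : Γ ⊆ b.support) (d : PosQuasiroot b Γ → ℂ) (α : PosOutside b Γ) :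
    eigenvalue d (bar Γ (negRoot α.1)) = d α.bar := by
  rw [bar_negRoot, eigenvalue, dif_neg, dif_pos]
  · congr 1
    exact Subtype.ext (neg_neg _)
  · rw [neg_neg]; exact α.bar.2
  · intro h
    exact PosQuasiroot.not_neg hΓ ⟨_, h⟩ α.bar rfl

theorem eigenvalue_zero (d : PosQuasiroot b Γ → ℂ) : eigenvalue d 0 = 0 := by
  rw [eigenvalue, dif_neg (by simp), dif_neg (by simp)]

theorem contract_bivector_rootVector (hE : IsRootVectors E) (hΓ : Γ ⊆ b.support)
    (d : PosQuasiroot b Γ → ℂ) (γ : H.root) :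
    contract (bivector E d) (E γ.1) = eigenvalue d (bar Γ γ) • E γ.1 := by
  classical
  refine (contract_sum (b := b) hE (fun α h => h.1) (fun α : PosOutside b Γ => d α.bar) γ).trans ?_
  congr 1
  split_ifs with h1 h2
  · exact (eigenvalue_pos d ⟨γ, h1⟩).symm
  · have := eigenvalue_neg hΓ d ⟨negRoot γ, h2⟩
    rw [negRoot_negRoot] at this
    exact this.symm
  · rw [eigenvalue, dif_neg, dif_neg]
    · intro h
      have : bar Γ (negRoot γ) = -bar Γ γ := bar_negRoot γ
      exact h2 ⟨isPos_of_bar_eq hΓ ⟨_, h⟩ this, (isOutside_iff _).2 (this ▸ h.1)⟩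
    · intro h
      exact h1 ⟨isPos_of_bar_eq hΓ ⟨_, h⟩ rfl, (isOutside_iff _).2 h.1⟩

/-- The contraction of `∑ c(ᾱ) E_α ∧ E_{-α}` acts on root spaces by scalars. -/
theorem contract_bivector (hE : IsRootVectors E) (hΓ : Γ ⊆ b.support)
    (d : PosQuasiroot b Γ → ℂ) (μ : Dual ℂ H) {x : g} (hx : x ∈ LieAlgebra.rootSpace H μ) :
    contract (bivector E d) x = eigenvalue d ((hGamma Γ).mkQ μ) • x := by
  rcases rootSpace_cases μ hx with rfl | ⟨rfl, -⟩ | ⟨γ, rfl, hγ⟩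
  · simp
  · rw [map_zero, eigenvalue_zero, zero_smul, bivector]
    simp only [map_sum, map_smul, LinearMap.sum_apply, LinearMap.smul_apply, contract_wedge₂]
    have h0 : ∀ α : H.root, killingForm ℂ g (E α.1) x = 0 := fun α =>
      killing_root_eq_zero (hE.mem_root α) hx (by
        rw [add_zero]
        exact (rootSystem H).ne_zero α)
    refine Finset.sum_eq_zero fun α _ => ?_
    rw [h0]
    erw [h0 (negRoot α.1)]
    simp
  · obtain ⟨t, rfl⟩ := hE.exists_smul γ hγ
    rw [map_smul, contract_bivector_rootVector hE hΓ, smul_comm]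
    rfl

open Classical in
-- The sum for `r` runs over all positive roots, including those of `Ω_Γ`, so its eigenvalues are
-- recorded on roots and not through `eigenvalue`.
theorem contract_rMatrix (hE : IsRootVectors E) (γ : H.root) :
    contract (rMatrix E b) (E γ.1) = (if b.IsPos γ then -1 else 1 : ℂ) • E γ.1 := by
  have h := contract_sum (b := b) (E := E) hE (p := fun α => b.IsPos α) (fun _ h => h)
    (fun _ => 1) γ (x := Fintype.ofFinite _)
  simp only [one_smul] at h
  refine h.trans ?_
  congr 1
  by_cases hγ : b.IsPos γ
  · rw [if_pos hγ, dif_pos hγ]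
  · rw [if_neg hγ, dif_neg hγ, dif_pos ((isPos_negRoot_iff b γ).2 hγ)]

end Levi

/-! ### The Schouten equation as a system of equations for the coefficients -/

section Equation

theorem pairingDual_map {V W : Type*} [AddCommGroup V] [Module ℂ V] [AddCommGroup W] [Module ℂ W]
    {n : ℕ} (φ : V →ₗ[ℂ] W) (f : Fin n → Dual ℂ W) (w : ⋀[ℂ]^n V) :
    exteriorPower.pairingDual ℂ W n (exteriorPower.ιMulti ℂ n f) (exteriorPower.map n φ w) =
      exteriorPower.pairingDual ℂ V n (exteriorPower.ιMulti ℂ n fun i => f i ∘ₗ φ) w := by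
  have : exteriorPower.pairingDual ℂ W n (exteriorPower.ιMulti ℂ n f) ∘ₗ exteriorPower.map n φ =
      exteriorPower.pairingDual ℂ V n (exteriorPower.ιMulti ℂ n fun i => f i ∘ₗ φ) := by
    apply exteriorPower.linearMap_ext
    ext m
    simp [exteriorPower.pairingDual_ιMulti_ιMulti, exteriorPower.map_apply_ιMulti]
  exact LinearMap.congr_fun this w

variable {g : Type*} [LieRing g] [LieAlgebra ℂ g] [FiniteDimensional ℂ g]
  [LieAlgebra.IsKilling ℂ g]

/-- Nondegeneracy of the Killing form: every functional is `killingForm ℂ g y` for some `y`, so the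
pairings `pair₂` detect bivectors. -/
theorem contract_injective : Function.Injective (contract : ⋀[ℂ]^2 g →ₗ[ℂ] (g →ₗ[ℂ] g)) := by
  rw [← LinearMap.ker_eq_bot, LinearMap.ker_eq_bot']
  intro v hv
  have hnd := killingForm_nondegenerate ℂ g
  let B := finBasis ℂ g
  refine multivector_eq_zero_of_pairing B B.coord (by simp)
    (fun i j hij => by simp [Finsupp.single_eq_of_ne hij]) (by rw [B.span_eq]) v fun a => ?_
  obtain ⟨y₁, h₁⟩ := (LinearMap.BilinForm.toDual (killingForm ℂ g) hnd).surjective (B.coord (a 0))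
  obtain ⟨y₂, h₂⟩ := (LinearMap.BilinForm.toDual (killingForm ℂ g) hnd).surjective (B.coord (a 1))
  have h : B.coord ∘ a = ![killingForm ℂ g y₁, killingForm ℂ g y₂] := by
    funext k
    fin_cases k
    · exact h₁.symm
    · exact h₂.symm
  rw [h]
  change pair₂ y₁ y₂ v = 0
  rw [pair₂_eq_contract, hv]
  simp

variable {H : LieSubalgebra ℂ g} [H.IsCartanSubalgebra]
  {b : (rootSystem H).Base} {Γ : Set H.root} {E : LieModule.Weight ℂ H g → g}

theorem bivector_mem_bivectorsInM (d : PosQuasiroot b Γ → ℂ) :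
    bivector E d ∈ bivectorsInM E Γ := by
  refine Submodule.sum_mem _ fun α _ => Submodule.smul_mem _ _ ?_
  refine ⟨wedge₂ ⟨E α.1.1, Submodule.subset_span ⟨α.1, α.2.2, rfl⟩⟩
    ⟨E (negRoot α.1).1, Submodule.subset_span ⟨negRoot α.1, isOutside_negRoot.2 α.2.2, rfl⟩⟩, ?_⟩
  rw [wedge₂, exteriorPower.map_apply_ιMulti, wedge₂]
  congr 1
  funext k
  fin_cases k <;> rfl

theorem bivector_injective (hE : IsRootVectors E) (hΓ : Γ ⊆ b.support) :
    Function.Injective (bivector E : (PosQuasiroot b Γ → ℂ) → ⋀[ℂ]^2 g) := by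
  intro d d' h
  funext ⟨q, hq, α, hα, hαq⟩
  subst hαq
  have h1 := contract_bivector_rootVector hE hΓ d α
  rw [h, contract_bivector_rootVector hE hΓ d' α] at h1
  have h2 := smul_left_injective ℂ (hE.ne_zero α) h1
  have h3 := eigenvalue_pos d ⟨α, hα, (isOutside_iff α).2 hq⟩
  have h4 := eigenvalue_pos d' ⟨α, hα, (isOutside_iff α).2 hq⟩
  simp only at h2 h3 h4
  rw [h3, h4] at h2
  exact (neg_injective h2).symm

/-- Bracketing with `x` of weight in `h*_Γ` does not change the class of a weight in `h*/h*_Γ`,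
hence not the eigenvalue of the contraction. The elements commuting with the contraction form a
subalgebra, so `levi_le` applies. -/
theorem bivector_isLeviInvariant (hE : IsRootVectors E) (hΓ : Γ ⊆ b.support)
    (d : PosQuasiroot b Γ → ℂ) : IsLeviInvariant E Γ (bivector E d) := by
  set v := bivector E d with hv
  let S : LieSubalgebra ℂ g :=
    { carrier := {x | ∀ y, contract v ⁅x, y⁆ = ⁅x, contract v y⁆}
      add_mem' := fun {a c} ha hc y => by rw [add_lie, map_add, ha y, hc y, add_lie]
      zero_mem' := fun y => by simp
      smul_mem' := fun t a ha y => by rw [smul_lie, map_smul, ha y, smul_lie]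
      lie_mem' := fun {a c} ha hc y => by
        rw [lie_lie, map_sub, ha, hc, hc, ha, lie_lie] }
  have hS : ∀ x ∈ levi E Γ, x ∈ S := by
    refine levi_le hE fun μ hμ x hx => ?_
    have hweight : ∀ (ν : Dual ℂ H) (y : g), y ∈ LieAlgebra.rootSpace H ν →
        contract v ⁅x, y⁆ = ⁅x, contract v y⁆ := by
      intro ν y hy
      rw [contract_bivector hE hΓ d _ (lie_mem_rootSpace hx hy), contract_bivector hE hΓ d _ hy,
        lie_smul, map_add]
      have : (hGamma Γ).mkQ μ = 0 := by simpa using hμ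
      rw [this, zero_add]
    have htop : (⊤ : Submodule ℂ g) ≤ LinearMap.eqLocus (contract v ∘ₗ LieAlgebra.ad ℂ g x)
        ((LieAlgebra.ad ℂ g x : g →ₗ[ℂ] g) ∘ₗ contract v) := by
      rw [← hE.span_eq_top, sup_le_iff, Submodule.span_le]
      constructor
      · exact fun y hy => hweight 0 y (mem_rootSpace_zero hy)
      · rintro _ ⟨α, rfl⟩
        exact hweight _ _ (hE.mem_root' α)
    exact fun y => htop (Submodule.mem_top (x := y))
  intro x hx
  apply contract_injective
  ext y
  rw [contract_adBivector, hS x hx y]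
  simp

/-- A trivector over `g` vanishes on `M` if and only if it pairs to zero with all triples of root
vectors in `m`. -/
theorem toM_eq_zero_iff (hE : IsRootVectors E) (hΓ : Γ ⊆ b.support) (w : ⋀[ℂ]^3 g) :
    toM E Γ w = 0 ↔ ∀ α β γ : H.root, IsOutside Γ α → IsOutside Γ β → IsOutside Γ γ →
      pair₃ (E α.1) (E β.1) (E γ.1) w = 0 := by
  have hker : ∀ α : {α : H.root // IsOutside Γ α},
      (levi E Γ).toSubmodule ≤ LinearMap.ker (killingForm ℂ g (E α.1.1)) := by
    intro α x hx
    rw [LinearMap.mem_ker, LieModule.traceForm_comm]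
    exact (levi_normalizes hE hx (Submodule.subset_span ⟨α.1, α.2, rfl⟩)).2
  let f : {α : H.root // IsOutside Γ α} → Dual ℂ (g ⧸ (levi E Γ).toSubmodule) := fun α =>
    (levi E Γ).toSubmodule.liftQ (killingForm ℂ g (E α.1.1)) (hker α)
  have hf : ∀ α, f α ∘ₗ (levi E Γ).toSubmodule.mkQ = killingForm ℂ g (E α.1.1) :=
    fun α => Submodule.liftQ_mkQ _ _ _
  have hpair : ∀ a : Fin 3 → {α : H.root // IsOutside Γ α},
      exteriorPower.pairingDual ℂ _ 3 (exteriorPower.ιMulti ℂ 3 (f ∘ a)) (toM E Γ w) =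
        pair₃ (E (a 0).1.1) (E (a 1).1.1) (E (a 2).1.1) w := by
    intro a
    rw [toM, pairingDual_map, pair₃]
    congr 3
  constructor
  · intro h α β γ hα hβ hγ
    have := hpair ![⟨α, hα⟩, ⟨β, hβ⟩, ⟨γ, hγ⟩]
    rw [h, map_zero] at this
    exact this.symm
  · intro h
    -- The functional dual to the class of `E_α` is the pairing with `E_{-α}`, hence the passage to
    -- negative roots.
    let n : {α : H.root // IsOutside Γ α} → {α : H.root // IsOutside Γ α} :=
      fun α => ⟨negRoot α.1, isOutside_negRoot.2 α.2⟩
    refine multivector_eq_zero_of_pairing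
      (fun α : {α : H.root // IsOutside Γ α} => (levi E Γ).toSubmodule.mkQ (E α.1.1))
      (f ∘ n) ?_ ?_ ?_ _ fun a => ?_
    · intro α
      change killingForm ℂ g (E (negRoot α.1).1) (E α.1.1) = 1
      rw [LieModule.traceForm_comm]
      exact hE.killing_neg α.1
    · intro α β hαβ
      change killingForm ℂ g (E (negRoot α.1).1) (E β.1.1) = 0
      refine hE.killing_eq_zero fun h => hαβ (Subtype.ext ?_)
      rw [h, negRoot_negRoot]
    · have h1 := congrArg (Submodule.map (levi E Γ).toSubmodule.mkQ) (levi_sup_mGamma hE hΓ)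
      rw [Submodule.map_sup, Submodule.mkQ_map_self, bot_sup_eq, Submodule.map_top,
        Submodule.range_mkQ, mGamma, Submodule.map_span] at h1
      rw [← h1]
      refine Submodule.span_mono ?_
      rintro _ ⟨_, ⟨α, hα, rfl⟩, rfl⟩
      exact ⟨⟨α, hα⟩, rfl⟩
    · rw [Function.comp_assoc, hpair]
      exact h _ _ _ (n (a 0)).2 (n (a 1)).2 (n (a 2)).2

theorem killing_lie_eq_zero (hE : IsRootVectors E) {α β γ : H.root}
    (h : (rootSystem H).root α + (rootSystem H).root β + (rootSystem H).root γ ≠ 0) :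
    killingForm ℂ g ⁅E α.1, E β.1⁆ (E γ.1) = 0 := by
  rw [LieModule.traceForm_comm]
  exact killing_root_eq_zero (hE.mem_root γ) (lie_mem_rootSpace (hE.mem_root' α) (hE.mem_root' β))
    (by rwa [add_comm])

theorem killing_lie_ne_zero (hE : IsRootVectors E) {α β γ : H.root}
    (h : (rootSystem H).root α + (rootSystem H).root β + (rootSystem H).root γ = 0) :
    killingForm ℂ g ⁅E α.1, E β.1⁆ (E γ.1) ≠ 0 := by
  have h' : (rootSystem H).root (negRoot γ) = (rootSystem H).root α + (rootSystem H).root β := by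
    rw [root_negRoot, neg_eq_iff_add_eq_zero, add_comm, h]
  have h1 := lie_ne_zero_of_root_add h' (hE.mem_root α) (hE.ne_zero α) (hE.mem_root β)
    (hE.ne_zero β)
  have h2 := lie_mem_rootSpace (hE.mem_root' α) (hE.mem_root' β)
  rw [← h'] at h2
  obtain ⟨t, ht⟩ := hE.exists_smul (negRoot γ) h2
  rw [ht] at h1 ⊢
  rw [map_smul, LinearMap.smul_apply, LieModule.traceForm_comm, hE.killing_neg, smul_eq_mul,
    mul_one]
  rintro rfl
  simp at h1

open Classical in
-- On root vectors both sides are multiples of `([E_α, E_β], E_γ)`. This number can be cancelled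
-- when the roots sum to zero and vanishes otherwise.
theorem satisfiesSchouten_iff_triples (hE : IsRootVectors E) (hΓ : Γ ⊆ b.support) (K : ℂ)
    (d : PosQuasiroot b Γ → ℂ) :
    SatisfiesSchouten E b Γ K (bivector E d) ↔
      ∀ α β γ : H.root, IsOutside Γ α → IsOutside Γ β → IsOutside Γ γ →
        (rootSystem H).root α + (rootSystem H).root β + (rootSystem H).root γ = 0 →
        eigenvalue d (bar Γ α) * eigenvalue d (bar Γ β) +
          eigenvalue d (bar Γ β) * eigenvalue d (bar Γ γ) +
          eigenvalue d (bar Γ γ) * eigenvalue d (bar Γ α) =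
        K ^ 2 * ((if b.IsPos α then -1 else 1) * (if b.IsPos β then -1 else 1) +
          (if b.IsPos β then -1 else 1) * (if b.IsPos γ then -1 else 1) +
          (if b.IsPos γ then -1 else 1) * (if b.IsPos α then -1 else 1)) := by
  rw [SatisfiesSchouten, phiM, ← map_smul, ← sub_eq_zero, ← map_sub, toM_eq_zero_iff hE hΓ]
  refine forall₃_congr fun α β γ => forall₃_congr fun _ _ _ => ?_
  have hd := contract_bivector_rootVector hE hΓ d
  have hr := contract_rMatrix (b := b) hE
  rw [map_sub, map_smul, pair₃_schouten_of_eigen (hd α) (hd β) (hd γ),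
    pair₃_schouten_of_eigen (hr α) (hr β) (hr γ), smul_eq_mul]
  by_cases h : (rootSystem H).root α + (rootSystem H).root β + (rootSystem H).root γ = 0
  · have hne := killing_lie_ne_zero hE h
    refine ⟨fun h1 _ => ?_, fun h1 => ?_⟩
    · apply mul_right_cancel₀ (mul_ne_zero two_ne_zero hne)
      linear_combination h1
    · linear_combination 2 * killingForm ℂ g ⁅E α.1, E β.1⁆ (E γ.1) * h1 h
  · rw [killing_lie_eq_zero hE h]
    exact ⟨fun _ h1 => absurd h1 h, fun _ => by ring⟩

/-- The equation `⟦v, v⟧ = K² φ_M` in terms of the coefficients of `v`. -/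
theorem satisfiesSchouten_iff (hE : IsRootVectors E) (hΓ : Γ ⊆ b.support) (K : ℂ)
    (d : PosQuasiroot b Γ → ℂ) :
    SatisfiesSchouten E b Γ K (bivector E d) ↔
      ∀ α β γ : PosOutside b Γ,
        (rootSystem H).root γ.1 = (rootSystem H).root α.1 + (rootSystem H).root β.1 →
        d γ.bar * (d α.bar + d β.bar) = d α.bar * d β.bar + K ^ 2 := by
  classical
  rw [satisfiesSchouten_iff_triples hE hΓ]
  have hneg : ∀ α : PosOutside b Γ, ¬ b.IsPos (negRoot α.1) := fun α => by
    rw [isPos_negRoot_iff, not_not]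
    exact α.2.1
  constructor
  · intro h α β γ hγ
    have := h α.1 β.1 (negRoot γ.1) α.2.2 β.2.2 (isOutside_negRoot.2 γ.2.2)
      (by rw [root_negRoot, hγ]; abel)
    rw [eigenvalue_pos, eigenvalue_pos, eigenvalue_neg hΓ, if_pos α.2.1, if_pos β.2.1,
      if_neg (hneg γ)] at this
    linear_combination -this
  · intro h α β γ hα hβ hγ hsum
    have hcases : ∀ α : H.root, IsOutside Γ α → (∃ a : PosOutside b Γ, α = a.1) ∨
        ∃ a : PosOutside b Γ, α = negRoot a.1 := by
      intro α hα
      by_cases hpos : b.IsPos α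
      · exact Or.inl ⟨⟨α, hpos, hα⟩, rfl⟩
      · exact Or.inr ⟨⟨negRoot α, (isPos_negRoot_iff b α).2 hpos, isOutside_negRoot.2 hα⟩,
          (negRoot_negRoot α).symm⟩
    have hno : ∀ α β γ : PosOutside b Γ, (rootSystem H).root α.1 + (rootSystem H).root β.1 +
        (rootSystem H).root γ.1 ≠ 0 := by
      intro α β γ h0
      refine hneg γ (RootPairing.Base.IsPos.add α.2.1 β.2.1 ?_)
      rw [root_negRoot, neg_eq_iff_add_eq_zero, add_comm, h0]
    -- Three roots of one sign cannot sum to zero. In each other sign pattern, the root whose sign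
    -- differs from the other two is, up to sign, their sum; the quadratic equation is unchanged by
    -- reversing all signs.
    rcases hcases α hα with ⟨a, rfl⟩ | ⟨a, rfl⟩ <;> rcases hcases β hβ with ⟨c, rfl⟩ | ⟨c, rfl⟩ <;>
      rcases hcases γ hγ with ⟨e, rfl⟩ | ⟨e, rfl⟩ <;>
      simp only [eigenvalue_pos, eigenvalue_neg hΓ, if_pos a.2.1, if_pos c.2.1, if_pos e.2.1,
        if_neg (hneg a), if_neg (hneg c), if_neg (hneg e), root_negRoot] at hsum ⊢
    · exact absurd hsum (hno a c e)
    · linear_combination -h a c e (by linear_combination (norm := module) (-1 : ℂ) • hsum)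
    · linear_combination -h a e c (by linear_combination (norm := module) (-1 : ℂ) • hsum)
    · linear_combination -h c e a (by linear_combination (norm := module) (1 : ℂ) • hsum)
    · linear_combination -h c e a (by linear_combination (norm := module) (-1 : ℂ) • hsum)
    · linear_combination -h a e c (by linear_combination (norm := module) (1 : ℂ) • hsum)
    · linear_combination -h a c e (by linear_combination (norm := module) (1 : ℂ) • hsum)
    · exact absurd (by linear_combination (norm := module) (-1 : ℂ) • hsum) (hno a c e)

end Equation

/-! ### Poisson brackets -/

section Poisson

variable {g : Type*} [LieRing g] [LieAlgebra ℂ g]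
  {A : Type*} [CommRing A] [Algebra ℂ A] (ρ : g →ₗ⁅ℂ⁆ Derivation ℂ A A)

/-- `bivectorBracket`, as a linear map in the bivector. -/
def bracketHom (a b : A) : ⋀[ℂ]^2 g →ₗ[ℂ] A :=
  liftBilin
    (LinearMap.mk₂ ℂ (fun x y => ρ x a * ρ y b - ρ y a * ρ x b)
      (by intros; simp; ring)
      (by intros; simp [smul_sub])
      (by intros; simp; ring)
      (by intros; simp [smul_sub]))
    (by intro x; simp)

theorem bivectorBracket_eq (v : ⋀[ℂ]^2 g) (a b : A) :
    bivectorBracket ρ v a b = bracketHom ρ a b v := rfl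

theorem bracketHom_wedge₂ (a b : A) (x y : g) :
    bracketHom ρ a b (wedge₂ x y) = ρ x a * ρ y b - ρ y a * ρ x b := by
  simp [bracketHom, liftBilin_wedge₂]

theorem bracketHom_add (a b c : A) :
    bracketHom ρ a (b + c) = bracketHom ρ a b + bracketHom ρ a c :=
  bivector_hom_ext fun x y => by simp [bracketHom_wedge₂]; ring

theorem bracketHom_smul (t : ℂ) (a b : A) :
    bracketHom ρ a (t • b) = t • bracketHom ρ a b :=
  bivector_hom_ext fun x y => by simp [bracketHom_wedge₂, smul_sub]

theorem bracketHom_skew (a b : A) : bracketHom ρ a b = -bracketHom ρ b a :=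
  bivector_hom_ext fun x y => by simp [bracketHom_wedge₂]; ring

theorem bracketHom_mul (a b c : A) (v : ⋀[ℂ]^2 g) :
    bracketHom ρ a (b * c) v = bracketHom ρ a b v * c + b * bracketHom ρ a c v := by
  have : bracketHom ρ a (b * c) = LinearMap.mulRight ℂ c ∘ₗ bracketHom ρ a b +
      LinearMap.mulLeft ℂ b ∘ₗ bracketHom ρ a c :=
    bivector_hom_ext fun x y => by simp [bracketHom_wedge₂]; ring
  exact LinearMap.congr_fun this v

theorem rho_lie (x y : g) (a : A) : ρ ⁅x, y⁆ a = ρ x (ρ y a) - ρ y (ρ x a) := by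
  rw [LieHom.map_lie, Derivation.commutator_apply]

/-- The Leibniz rule for the action of `x` on `v(da, db)`; with `v` invariant it shows that the
bracket preserves the functions killed by `g_Γ`. -/
theorem apply_bracketHom (x : g) (a b : A) (v : ⋀[ℂ]^2 g) :
    ρ x (bracketHom ρ a b v) = bracketHom ρ (ρ x a) b v + bracketHom ρ a (ρ x b) v +
      bracketHom ρ a b (adBivector x v) := by
  have : (ρ x : A →ₗ[ℂ] A) ∘ₗ bracketHom ρ a b = bracketHom ρ (ρ x a) b + bracketHom ρ a (ρ x b) +
      bracketHom ρ a b ∘ₗ adBivector x := by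
    refine bivector_hom_ext fun y z => ?_
    simp [bracketHom_wedge₂, adBivector, liftBilin_wedge₂, Derivation.commutator_apply]
    ring
  exact LinearMap.congr_fun this v

/-- The value of a decomposable trivector on three elements along a linear map into functionals. -/
def evalTrivector {V : Type*} [AddCommGroup V] [Module ℂ V] (f₁ f₂ f₃ : V →ₗ[ℂ] A) :
    ⋀[ℂ]^3 V →ₗ[ℂ] A :=
  exteriorPower.alternatingMapLinearEquiv
    { toFun := fun m => (Matrix.of fun i j => (![f₁, f₂, f₃] : Fin 3 → V →ₗ[ℂ] A) j (m i)).det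
      map_update_add' := by
        intro inst m i x y
        obtain rfl : inst = instDecidableEqFin 3 := Subsingleton.elim _ _
        fin_cases i <;> simp [Matrix.det_fin_three] <;> ring
      map_update_smul' := by
        intro inst m i c x
        obtain rfl : inst = instDecidableEqFin 3 := Subsingleton.elim _ _
        fin_cases i <;> simp [Matrix.det_fin_three, smul_sub, smul_add]
      map_eq_zero_of_eq' := by
        intro m i j h hij
        exact Matrix.det_zero_of_row_eq hij (by funext k; simp [h]) }

theorem evalTrivector_wedge₃ {V : Type*} [AddCommGroup V] [Module ℂ V] (f₁ f₂ f₃ : V →ₗ[ℂ] A)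
    (x y z : V) : evalTrivector f₁ f₂ f₃ (wedge₃ x y z) =
      f₁ x * f₂ y * f₃ z - f₁ x * f₃ y * f₂ z - f₂ x * f₁ y * f₃ z + f₂ x * f₃ y * f₁ z +
        f₃ x * f₁ y * f₂ z - f₃ x * f₂ y * f₁ z := by
  simp [evalTrivector, wedge₃, Matrix.det_fin_three]

theorem evalTrivector_map {V W : Type*} [AddCommGroup V] [Module ℂ V] [AddCommGroup W]
    [Module ℂ W] (φ : V →ₗ[ℂ] W) (f₁ f₂ f₃ : W →ₗ[ℂ] A) (w : ⋀[ℂ]^3 V) :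
    evalTrivector f₁ f₂ f₃ (exteriorPower.map 3 φ w) =
      evalTrivector (f₁ ∘ₗ φ) (f₂ ∘ₗ φ) (f₃ ∘ₗ φ) w := by
  have : evalTrivector f₁ f₂ f₃ ∘ₗ exteriorPower.map 3 φ =
      evalTrivector (f₁ ∘ₗ φ) (f₂ ∘ₗ φ) (f₃ ∘ₗ φ) := by
    apply exteriorPower.linearMap_ext
    ext m
    simp [evalTrivector, exteriorPower.map_apply_ιMulti, Matrix.det_fin_three]
  exact LinearMap.congr_fun this w

/-- The linear map `x ↦ x(a)`. -/
def evalAt (a : A) : g →ₗ[ℂ] A where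
  toFun x := ρ x a
  map_add' x y := by simp
  map_smul' t x := by simp

/-- The polarized Jacobiator of the brackets of two bivectors is their Schouten bracket. -/
theorem jacobiator (v w : ⋀[ℂ]^2 g) (a b c : A) :
    evalTrivector (evalAt ρ a) (evalAt ρ b) (evalAt ρ c) (schouten v w) =
      (bracketHom ρ a (bracketHom ρ b c v) w + bracketHom ρ a (bracketHom ρ b c w) v) +
      (bracketHom ρ b (bracketHom ρ c a v) w + bracketHom ρ b (bracketHom ρ c a w) v) +
      (bracketHom ρ c (bracketHom ρ a b v) w + bracketHom ρ c (bracketHom ρ a b w) v) := by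
  let F : A → A → A → ⋀[ℂ]^2 g →ₗ[ℂ] ⋀[ℂ]^2 g →ₗ[ℂ] A := fun a b c =>
    { toFun := fun v => bracketHom ρ a (bracketHom ρ b c v)
      map_add' := fun v v' => by rw [map_add, bracketHom_add]
      map_smul' := fun t v => by rw [map_smul, bracketHom_smul]; rfl }
  have hF : ∀ a b c v w, F a b c v w = bracketHom ρ a (bracketHom ρ b c v) w :=
    fun a b c v w => rfl
  -- Polarization makes both sides bilinear in the bivectors, so decomposables suffice; there the
  -- second-order terms combine into commutators.
  have key : schouten.compr₂ (evalTrivector (evalAt ρ a) (evalAt ρ b) (evalAt ρ c)) =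
      (F a b c + (F a b c).flip) + (F b c a + (F b c a).flip) + (F c a b + (F c a b).flip) := by
    refine bivector_hom_ext fun x₁ x₂ => bivector_hom_ext fun x₃ x₄ => ?_
    simp only [LinearMap.compr₂_apply, schouten_wedge₂, schoutenDecomp, map_add, map_sub,
      evalTrivector_wedge₃, LinearMap.add_apply, LinearMap.flip_apply, hF, bracketHom_wedge₂,
      evalAt, LinearMap.coe_mk, AddHom.coe_mk, rho_lie, Derivation.leibniz, smul_eq_mul]
    ring
  exact LinearMap.congr_fun₂ key v w

variable [FiniteDimensional ℂ g] [LieAlgebra.IsKilling ℂ g]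
  {H : LieSubalgebra ℂ g} [H.IsCartanSubalgebra]
  {Γ : Set H.root} {E : LieModule.Weight ℂ H g → g}

/-- An invariant bivector whose Schouten square vanishes on `M` defines a Poisson bracket. -/
theorem definesPoissonBracket {v : ⋀[ℂ]^2 g} (hinv : IsLeviInvariant E Γ v)
    (hv : toM E Γ (schouten v v) = 0) : DefinesPoissonBracket.{w} E Γ v := by
  intro A _ _ ρ
  constructor
  · intro a ha b hb x hx
    rw [bivectorBracket_eq, apply_bracketHom, hinv x hx, ha x hx, hb x hx]
    have h0 : ∀ b : A, bracketHom ρ b 0 = 0 := fun b => by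
      simpa using bracketHom_smul ρ 0 b 0
    rw [bracketHom_skew ρ 0 b, h0, h0]
    simp
  · intro a _ b _ c _
    rw [bivectorBracket_eq, bracketHom_add]; rfl
  · intro t a _ b _
    rw [bivectorBracket_eq, bracketHom_smul]; rfl
  · intro a _ b _
    rw [bivectorBracket_eq, bracketHom_skew]; rfl
  · intro a _ b _ c _
    exact bracketHom_mul ρ a b c v
  · intro a ha b hb c hc
    -- For `a` annihilated by `g_Γ`, the functional `x ↦ x(a)` descends to `g/g_Γ`, so only the
    -- reduced Schouten square enters the Jacobiator.
    have hker : ∀ a ∈ {a : A | ∀ x ∈ levi E Γ, ρ x a = 0},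
        (levi E Γ).toSubmodule ≤ LinearMap.ker (evalAt ρ a) := fun a ha x hx => ha x hx
    have h := congrArg (evalTrivector ((levi E Γ).toSubmodule.liftQ _ (hker a ha))
      ((levi E Γ).toSubmodule.liftQ _ (hker b hb))
      ((levi E Γ).toSubmodule.liftQ _ (hker c hc))) hv
    rw [toM, evalTrivector_map, map_zero, Submodule.liftQ_mkQ, Submodule.liftQ_mkQ,
      Submodule.liftQ_mkQ, jacobiator] at h
    -- On the diagonal `w = v` the two polarized terms agree, which doubles the Jacobiator.
    have h2 : (2 : ℂ) • (bracketHom ρ a (bracketHom ρ b c v) v +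
        bracketHom ρ b (bracketHom ρ c a v) v + bracketHom ρ c (bracketHom ρ a b v) v) = 0 := by
      rw [← h, two_smul]; ring
    exact (smul_eq_zero.1 h2).resolve_left two_ne_zero

end Poisson

/-! ### Solutions of the coefficient equations -/

section Solutions

variable {g : Type*} [LieRing g] [LieAlgebra ℂ g] [FiniteDimensional ℂ g]
  [LieAlgebra.IsKilling ℂ g]
  {H : LieSubalgebra ℂ g} [H.IsCartanSubalgebra]
  {b : (rootSystem H).Base} {Γ : Set H.root} {E : LieModule.Weight ℂ H g → g}

theorem simpleValues_simple (hΓ : Γ ⊆ b.support) (c : SimpleOutside b Γ → ℂ)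
    (i : SimpleOutside b Γ) : simpleValues hΓ c (simpleQuasiroot hΓ i) = {c i} := by
  rw [simpleValues, decomposition_simple, Multiset.map_singleton]

theorem simpleValues_add (hΓ : Γ ⊆ b.support) (c : SimpleOutside b Γ → ℂ) {α β γ : PosOutside b Γ}
    (h : (rootSystem H).root γ.1 = (rootSystem H).root α.1 + (rootSystem H).root β.1) :
    simpleValues hΓ c γ.bar = simpleValues hΓ c α.bar + simpleValues hΓ c β.bar := by
  have h' : γ.bar.1 = α.bar.1 + β.bar.1 := bar_add h
  rw [simpleValues, decomposition_add hΓ h', Multiset.map_add]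
  rfl

theorem coeffFormula_simple (hΓ : Γ ⊆ b.support) (K : ℂ) (c : SimpleOutside b Γ → ℂ)
    (i : SimpleOutside b Γ) : coeffFormula hΓ K c (simpleQuasiroot hΓ i) = c i := by
  rw [coeffFormula, simpleValues_simple, numer_singleton, denom_singleton, div_one]

theorem satisfiesSchouten_coeffFormula (hE : IsRootVectors E) (hΓ : Γ ⊆ b.support) {K : ℂ}
    {c : SimpleOutside b Γ → ℂ} (hc : c ∈ admissible hΓ K) :
    SatisfiesSchouten E b Γ K (bivector E (coeffFormula hΓ K c)) := by
  rw [satisfiesSchouten_iff hE hΓ]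
  intro α β γ h
  have hγ := hc.2 γ.bar
  simp only [coeffFormula]
  rw [simpleValues_add hΓ c h] at hγ ⊢
  exact quotient_relation (hc.2 α.bar) (hc.2 β.bar) hγ

/-- When a simple root with value `cᵢ` is added to `α`, the relation is linear in the new
coefficient with factor `c(ᾱ) + cᵢ`, the quotient of the new denominator by the old; admissibility
makes it nonzero. -/
theorem eq_coeffFormula (hE : IsRootVectors E) (hΓ : Γ ⊆ b.support) {K : ℂ}
    {c : SimpleOutside b Γ → ℂ} (hc : c ∈ admissible hΓ K) {d : PosQuasiroot b Γ → ℂ}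
    (hd : ∀ i, d (simpleQuasiroot hΓ i) = c i)
    (h : SatisfiesSchouten E b Γ K (bivector E d)) : d = coeffFormula hΓ K c := by
  rw [satisfiesSchouten_iff hE hΓ] at h
  funext q
  refine posQuasiroot_induction hΓ (P := fun q => d q = coeffFormula hΓ K c q) (fun i => ?_)
    (fun α i γ hγ ih => ?_) q
  · rw [hd, coeffFormula_simple]
  · have h1 := h α (i.toPosOutside hΓ) γ hγ
    have h2 : simpleValues hΓ c γ.bar = simpleValues hΓ c α.bar + {c i} := by
      rw [simpleValues_add hΓ c (β := i.toPosOutside hΓ) hγ, ← simpleValues_simple hΓ c i]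
      rfl
    have h3 : d (i.toPosOutside hΓ).bar = c i := hd i
    have h4 := hc.2 γ.bar
    rw [h3, ih] at h1
    simp only [coeffFormula] at h1 ⊢
    rw [h2] at h4 ⊢
    exact eq_quotient_of_relation (hc.2 α.bar) h4 h1

/-- The admissible points are the complement of the zero set of a nonzero polynomial. -/
theorem exists_polynomial_admissible (hΓ : Γ ⊆ b.support) (K : ℂ) :
    ∃ p : MvPolynomial (SimpleOutside b Γ) ℂ, p ≠ 0 ∧
      ∀ c, c ∈ admissible hΓ K ↔ MvPolynomial.eval c p ≠ 0 := by
  have := Fintype.ofFinite (PosQuasiroot b Γ)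
  have := Fintype.ofFinite (SimpleOutside b Γ)
  choose _ Q hQ using fun q : PosQuasiroot b Γ =>
    exists_polynomial_numer_denom K (decomposition hΓ q)
  have hiff : ∀ c, c ∈ admissible hΓ K ↔
      MvPolynomial.eval c ((∏ i, MvPolynomial.X i) * ∏ q, Q q) ≠ 0 := by
    intro c
    rw [map_mul, map_prod, map_prod, mul_ne_zero_iff, Finset.prod_ne_zero_iff,
      Finset.prod_ne_zero_iff]
    simp [admissible, simpleValues, (hQ _ c).2]
  refine ⟨_, ?_, hiff⟩
  -- The polynomial is nonzero because one constant point is admissible.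
  obtain ⟨t, ht, hden⟩ := exists_denom_replicate_ne_zero K
  have hmem : (fun _ => t) ∈ admissible hΓ K := by
    refine ⟨fun _ => ht, fun q => ?_⟩
    rw [simpleValues, Multiset.map_const']
    exact hden _ (by simpa using decomposition_ne_zero hΓ q)
  intro h0
  exact (hiff _).1 hmem (by rw [h0, map_zero])

theorem bijOn_bracketFamily (hE : IsRootVectors E) (hΓ : Γ ⊆ b.support) (K : ℂ) :
    Set.BijOn (fun c => bivector E (coeffFormula hΓ K c)) (admissible hΓ K)
      (bracketFamily E hΓ K) := by
  refine ⟨fun c hc => ?_, fun c _ c' _ h => ?_, ?_⟩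
  · refine ⟨bivector_mem_bivectorsInM _, bivector_isLeviInvariant hE hΓ _,
      satisfiesSchouten_coeffFormula hE hΓ hc, _, rfl, ?_⟩
    simpa only [coeffFormula_simple] using hc
  · have h1 := bivector_injective hE hΓ h
    funext i
    rw [← coeffFormula_simple hΓ K c i, h1, coeffFormula_simple]
  -- Surjectivity is uniqueness, applied to the point formed by the values of `d` at the simple
  -- quasiroots.
  · rintro v ⟨-, -, hv, d, rfl, hd⟩
    exact ⟨_, hd, congrArg _ (eq_coeffFormula hE hΓ hd (fun _ => rfl) hv).symm⟩

/-- The linear form on `h*/h*_Γ` with prescribed values at the simple quasiroots. -/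
theorem exists_linearForm (hΓ : Γ ⊆ b.support) (c : SimpleOutside b Γ → ℂ) :
    ∃ l : Dual ℂ (Dual ℂ H ⧸ hGamma Γ), ∀ i, l (simpleQuasiroot hΓ i).1 = c i := by
  classical
  let f : Dual ℂ H →ₗ[ℂ] ℂ := b.toWeightBasis.constr ℂ fun i : b.support =>
    if h : i.1 ∉ Γ then c ⟨i.1, i.2, h⟩ else 0
  have hf : ∀ i (hi : i ∈ b.support), f ((rootSystem H).root i) =
      if h : i ∉ Γ then c ⟨i, hi, h⟩ else 0 := by
    intro i hi
    rw [← b.toWeightBasis_apply ⟨i, hi⟩, Basis.constr_basis]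
  have hker : hGamma Γ ≤ LinearMap.ker f := by
    rw [hGamma, Submodule.span_le]
    rintro _ ⟨j, hj, rfl⟩
    rw [SetLike.mem_coe, LinearMap.mem_ker, hf j (hΓ hj), dif_neg (not_not.2 hj)]
  refine ⟨(hGamma Γ).liftQ f hker, fun i => ?_⟩
  change f ((rootSystem H).root i.1) = _
  rw [hf i.1 i.2.1, dif_pos i.2.2]

/-- For `K = 0` the relation reads `1/c(γ̄) = 1/c(ᾱ) + 1/c(β̄)`, so `1/c` agrees with the linear
form having its values at the simple quasiroots. -/
theorem exists_linearForm_of_satisfiesSchouten (hE : IsRootVectors E) (hΓ : Γ ⊆ b.support)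
    {d : PosQuasiroot b Γ → ℂ} (h : SatisfiesSchouten E b Γ 0 (bivector E d))
    (hd : ∀ i, d (simpleQuasiroot hΓ i) ≠ 0) :
    ∃ l : Dual ℂ (Dual ℂ H ⧸ hGamma Γ),
      (∀ q ∈ quasiroots Γ, l q ≠ 0) ∧ ∀ q : PosQuasiroot b Γ, d q = 1 / l q.1 := by
  rw [satisfiesSchouten_iff hE hΓ] at h
  obtain ⟨l, hl⟩ := exists_linearForm hΓ fun i => 1 / d (simpleQuasiroot hΓ i)
  have key : ∀ q : PosQuasiroot b Γ, d q ≠ 0 ∧ l q.1 = 1 / d q := by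
    refine posQuasiroot_induction hΓ (fun i => ⟨hd i, hl i⟩) fun α i γ hγ ih => ?_
    have h1 := h α (i.toPosOutside hΓ) γ hγ
    have h2 : d (i.toPosOutside hΓ).bar ≠ 0 := hd i
    have h3 : l (i.toPosOutside hΓ).bar.1 = 1 / d (i.toPosOutside hΓ).bar := hl i
    have h4 : γ.bar.1 = α.bar.1 + (i.toPosOutside hΓ).bar.1 := bar_add hγ
    rw [zero_pow two_ne_zero, add_zero] at h1
    -- The product `c(ᾱ) cᵢ` is nonzero and equals `c(γ̄)(c(ᾱ) + cᵢ)`, so nonvanishing of the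
    -- coefficients propagates along the induction.
    have h5 := mul_ne_zero ih.1 h2
    rw [← h1] at h5
    have h6 := left_ne_zero_of_mul h5
    refine ⟨h6, ?_⟩
    rw [h4, map_add, ih.2, h3]
    have h7 := ih.1
    field_simp
    linear_combination h1
  have hne : ∀ q : PosQuasiroot b Γ, l q.1 ≠ 0 := fun q => by
    rw [(key q).2]
    exact one_div_ne_zero (key q).1
  refine ⟨l, ?_, fun q => by rw [(key q).2, one_div_one_div]⟩
  rintro _ ⟨hq, α, rfl⟩
  by_cases hα : b.IsPos α
  · exact hne ⟨_, hq, α, hα, rfl⟩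
  · have := hne ⟨bar Γ (negRoot α), by rwa [bar_negRoot, neg_ne_zero], negRoot α,
      (isPos_negRoot_iff b α).2 hα, rfl⟩
    simp only [bar_negRoot, map_neg] at this
    exact neg_ne_zero.1 this

end Solutions

end SemisimpleOrbit

end

theorem proposition3p4 {g : Type u} [LieRing g] [LieAlgebra ℂ g] [FiniteDimensional ℂ g]
    [LieAlgebra.IsSimple ℂ g]
    (H : LieSubalgebra ℂ g) [H.IsCartanSubalgebra]
    (b : (LieAlgebra.IsKilling.rootSystem H).Base)
    (E : LieModule.Weight ℂ H g → g) (hE : IsRootVectors E)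
    (Γ : Set H.root) (hΓ : Γ ⊆ b.support) :
    -- a)
    (∀ K : ℂ,
      (∃ p : MvPolynomial (SimpleOutside b Γ) ℂ, p ≠ 0 ∧
        ∀ c, c ∈ admissible hΓ K ↔ MvPolynomial.eval c p ≠ 0) ∧
      (∀ c ∈ admissible hΓ K,
        (∀ i, coeffFormula hΓ K c (simpleQuasiroot hΓ i) = c i) ∧
        bivector E (coeffFormula hΓ K c) ∈ bivectorsInM E Γ ∧
        IsLeviInvariant E Γ (bivector E (coeffFormula hΓ K c)) ∧
        SatisfiesSchouten E b Γ K (bivector E (coeffFormula hΓ K c)) ∧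
        ∀ d : PosQuasiroot b Γ → ℂ, (∀ i, d (simpleQuasiroot hΓ i) = c i) →
          SatisfiesSchouten E b Γ K (bivector E d) → d = coeffFormula hΓ K c) ∧
      Set.BijOn (fun c => bivector E (coeffFormula hΓ K c))
        (admissible hΓ K) (bracketFamily E hΓ K)) ∧
    -- b)
    (∀ d : PosQuasiroot b Γ → ℂ, SatisfiesSchouten E b Γ 0 (bivector E d) →
      toM E Γ (schouten (bivector E d) (bivector E d)) = 0 ∧
      DefinesPoissonBracket.{w, u} E Γ (bivector E d) ∧
      ((∀ i, d (simpleQuasiroot hΓ i) ≠ 0) →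
        ∃ l : Module.Dual ℂ (Module.Dual ℂ H ⧸ hGamma Γ),
          (∀ q ∈ quasiroots Γ, l q ≠ 0) ∧ ∀ q : PosQuasiroot b Γ, d q = 1 / l q.1)) := by
  refine ⟨fun K => ⟨exists_polynomial_admissible hΓ K, fun c hc => ?_,
    bijOn_bracketFamily hE hΓ K⟩, fun d hd => ?_⟩
  · exact ⟨coeffFormula_simple hΓ K c, bivector_mem_bivectorsInM _,
      bivector_isLeviInvariant hE hΓ _, satisfiesSchouten_coeffFormula hE hΓ hc,
      fun d hdc hd => eq_coeffFormula hE hΓ hc hdc hd⟩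
  · have h0 : toM E Γ (schouten (bivector E d) (bivector E d)) = 0 := by
      rw [SatisfiesSchouten] at hd
      rw [hd, zero_pow two_ne_zero, zero_smul]
    exact ⟨h0, definesPoissonBracket (bivector_isLeviInvariant hE hΓ d) h0,
      exists_linearForm_of_satisfiesSchouten hE hΓ hd⟩
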